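/- Fix an integer $n\ge 2$ and let $T_n$ be the infinite tree in which every vertex has exactly $n+1$ neighbours. A way is an infinite sequence of vertices $a_0,a_1,\dots$ with $a_i,a_{i+1}$ adjacent and $a_{i+2}\ne a_i$. The boundary $\mathrm{Abs}(T_n)$ is the set of ways modulo the relation of coinciding from some moment on up to a shift of the numbering. Its topology is generated by the balls: cutting an edge at its middle splits $T_n$ into two branches, and the ball of a branch is the set of classes of ways lying in that branch. The group $\mathrm{Aut}(T_n)$ of automorphisms of $T_n$ acts on $\mathrm{Abs}(T_n)$ by homeomorphisms. A spheromorphism is a homeomorphism $q$ of $\mathrm{Abs}(T_n)$ such that every $y\in\mathrm{Abs}(T_n)$ has a neighbourhood on which $q$ coincides with some $r_y\in\mathrm{Aut}(T_n)$. Let $\mathrm{Hier}(T_n)\supset \mathrm{Aut}(T_n)$ be the group of all spheromorphisms. Equip it with the topology in which the sets $gS$, where $S\subset \mathrm{Aut}(T_n)$ runs over the pointwise stabilizers of finite sets of vertices, form a base of neighbourhoods of $g$; that is, $\mathrm{Aut}(T_n)$ with its usual topology is an open subgroup. Theorem. The subgroup $\mathrm{Aut}(T_n)$ is spherical in $\mathrm{Hier}(T_n)$.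 That is, $\mathrm{Hier}(T_n)$ is a topological group, $\mathrm{Aut}(T_n)$ is closed in it, and: A) for every irreducible (strongly continuous) unitary representation of $\mathrm{Hier}(T_n)$ in a complex Hilbert space, the subspace of $\mathrm{Aut}(T_n)$-fixed vectors has dimension at most $1$; B) there are a faithful (strongly continuous) unitary representation of $\mathrm{Hier}(T_n)$ in a complex Hilbert space and a vector $v$ in this space whose stabilizer in $\mathrm{Hier}(T_n)$ is exactly $\mathrm{Aut}(T_n)$. -/

import Mathlib

open scoped Topology

universe u w

namespace SimpleGraph

variable {V : Type u}

/-- A (one-sided) way: an infinite non-backtracking sequence of adjacent vertices. -/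
@[ext]
structure Way (T : SimpleGraph V) where
  vertex : ℕ → V
  adj : ∀ i, T.Adj (vertex i) (vertex (i + 1))
  ne : ∀ i, vertex (i + 2) ≠ vertex i

/-- Two ways are equivalent if they coincide from some moment on, up to a shift of the numbering. -/
def waySetoid (T : SimpleGraph V) : Setoid T.Way where
  r a b := ∃ k l : ℕ, ∀ i, a.vertex (i + k) = b.vertex (i + l)
  iseqv :=
    { refl := fun _ => ⟨0, 0, fun _ => rfl⟩
      symm := fun ⟨k, l, h⟩ => ⟨l, k, fun i => (h i).symm⟩
      trans := by
        rintro a b c ⟨k, l, h⟩ ⟨k', l', h'⟩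
        refine ⟨k' + k, l + l', fun i => ?_⟩
        have h1 := h (i + k')
        have h2 := h' (i + l)
        rw [show i + (k' + k) = i + k' + k by omega, h1,
          show i + k' + l = i + l + k' by omega, h2,
          show i + l + l' = i + (l + l') by omega] }

/-- The boundary `Abs(T)`: the set of classes of equivalent ways. -/
def Abs (T : SimpleGraph V) : Type u := Quotient T.waySetoid

/-- The branch obtained by cutting the edge `pq` at its middle and taking the piece containing
`q` (as a set of vertices). -/
def branch (T : SimpleGraph V) (p q : V) : Set V :=
  {v | (T.deleteEdges {s(p, q)}).Reachable q v}

/-- The ball of the boundary determined by a branch: the classes of the ways lying in it. -/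
def absBall (T : SimpleGraph V) (p q : V) : Set T.Abs :=
  {x | ∃ a : T.Way, (∀ i, a.vertex i ∈ T.branch p q) ∧ Quotient.mk T.waySetoid a = x}

/-- The topology of the boundary is generated by the balls. -/
instance absTopology (T : SimpleGraph V) : TopologicalSpace T.Abs :=
  TopologicalSpace.generateFrom {B | ∃ p q : V, T.Adj p q ∧ B = T.absBall p q}

variable {T : SimpleGraph V}

/-- The image of a way under an automorphism. -/
def Way.map (k : T ≃g T) (a : T.Way) : T.Way where
  vertex i := k (a.vertex i)
  adj i := k.map_adj_iff.mpr (a.adj i)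
  ne i h := a.ne i (k.injective h)

/-- The action of an automorphism on the boundary. -/
def absMap (k : T ≃g T) : T.Abs → T.Abs :=
  Quotient.map (Way.map k) fun _ _ ⟨m, l, h⟩ => ⟨m, l, fun i => congrArg k (h i)⟩

theorem absMap_mul (k l : T ≃g T) (x : T.Abs) : absMap (k * l) x = absMap k (absMap l x) := by
  induction x using Quotient.inductionOn with
  | h a => rfl

theorem absMap_one (x : T.Abs) : absMap (1 : T ≃g T) x = x := by
  induction x using Quotient.inductionOn with
  | h a => rfl

theorem map_mem_branch (k : T ≃g T) {p q v : V} (h : v ∈ T.branch p q) :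
    k v ∈ T.branch (k p) (k q) := by
  let f : T.deleteEdges {s(p, q)} →g T.deleteEdges {s(k p, k q)} :=
    { toFun := k
      map_rel' := by
        intro x y hxy
        rw [deleteEdges_adj] at hxy ⊢
        refine ⟨k.map_adj_iff.mpr hxy.1, fun hs => hxy.2 ?_⟩
        have hs' : Sym2.map k s(x, y) = Sym2.map k s(p, q) := hs
        exact Sym2.map.injective k.injective hs' }
  exact Reachable.map f h

theorem absMap_mem_absBall (k : T ≃g T) {p q : V} {x : T.Abs} (h : x ∈ T.absBall p q) :
    absMap k x ∈ T.absBall (k p) (k q) := by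
  obtain ⟨a, ha, rfl⟩ := h
  exact ⟨Way.map k a, fun i => map_mem_branch k (ha i), rfl⟩

theorem absMap_inv_absMap (k : T ≃g T) (x : T.Abs) : absMap k⁻¹ (absMap k x) = x := by
  rw [← absMap_mul, inv_mul_cancel, absMap_one]

theorem absMap_absMap_inv (k : T ≃g T) (x : T.Abs) : absMap k (absMap k⁻¹ x) = x := by
  rw [← absMap_mul, mul_inv_cancel, absMap_one]

theorem continuous_absMap (k : T ≃g T) : Continuous (absMap k) := by
  refine continuous_generateFrom_iff.mpr ?_
  rintro _ ⟨p, q, hpq, rfl⟩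
  have : absMap k ⁻¹' T.absBall p q = T.absBall (k⁻¹ p) (k⁻¹ q) := by
    ext x
    constructor
    · intro hx
      have := absMap_mem_absBall k⁻¹ hx
      rwa [absMap_inv_absMap] at this
    · intro hx
      have := absMap_mem_absBall k hx
      have hp : k (k⁻¹ p) = p := k.apply_symm_apply p
      have hq : k (k⁻¹ q) = q := k.apply_symm_apply q
      rwa [hp, hq] at this
  rw [this]
  exact TopologicalSpace.isOpen_generateFrom_of_mem
    ⟨_, _, (k⁻¹).map_adj_iff.mpr hpq, rfl⟩

/-- The action of the group of automorphisms on the boundary by homeomorphisms. -/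
def absHomeo (T : SimpleGraph V) : (T ≃g T) →* (T.Abs ≃ₜ T.Abs) where
  toFun k :=
    { toFun := absMap k
      invFun := absMap k⁻¹
      left_inv := absMap_inv_absMap k
      right_inv := absMap_absMap_inv k
      continuous_toFun := continuous_absMap k
      continuous_invFun := continuous_absMap k⁻¹ }
  map_one' := Homeomorph.ext absMap_one
  map_mul' k l := Homeomorph.ext (absMap_mul k l)

/-- The homeomorphisms of the boundary that coincide with automorphisms of the tree in a
neighborhood of each point form a group. -/
def spheromorphisms (T : SimpleGraph V) : Subgroup (T.Abs ≃ₜ T.Abs) where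
  carrier := {q | ∀ y, ∃ N ∈ 𝓝 y, ∃ r : T ≃g T, ∀ x ∈ N, q x = T.absHomeo r x}
  one_mem' y := ⟨Set.univ, Filter.univ_mem, 1, fun x _ => by rw [map_one]⟩
  mul_mem' := by
    intro g h hg hh y
    obtain ⟨N, hN, r, hr⟩ := hh y
    obtain ⟨M, hM, s, hs⟩ := hg (h y)
    refine ⟨N ∩ h ⁻¹' M, Filter.inter_mem hN (h.continuous.continuousAt hM), s * r, ?_⟩
    intro x hx
    rw [map_mul]
    change g (h x) = T.absHomeo s (T.absHomeo r x)
    rw [hs _ hx.2, hr _ hx.1]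
  inv_mem' := by
    intro g hg y
    obtain ⟨N, hN, r, hr⟩ := hg (g.symm y)
    refine ⟨g.symm ⁻¹' N, g.symm.continuous.continuousAt hN, r⁻¹, ?_⟩
    intro x hx
    change g.symm x = _
    have h1 : x = T.absHomeo r (g.symm x) := by
      rw [← hr _ hx, Homeomorph.apply_symm_apply]
    conv_rhs => rw [h1]
    exact (absMap_inv_absMap r _).symm

/-- The group `Hier(T)` of spheromorphisms (hierarchomorphisms). -/
def Hier (T : SimpleGraph V) : Type u := T.spheromorphisms

instance (T : SimpleGraph V) : Group T.Hier :=
  inferInstanceAs (Group T.spheromorphisms)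

/-- Each automorphism of the tree is a spheromorphism. -/
def autToHier (T : SimpleGraph V) : (T ≃g T) →* T.Hier :=
  T.absHomeo.codRestrict T.spheromorphisms
    fun k _ => ⟨Set.univ, Filter.univ_mem, k, fun _ _ => rfl⟩

/-- The subgroup `Aut(T)` of `Hier(T)`. -/
def autSubgroup (T : SimpleGraph V) : Subgroup T.Hier := T.autToHier.range

/-- The topology of `Hier(T)`: a base of neighborhoods of `g` is formed by the sets `g * S`, where
`S` is the pointwise stabilizer in `Aut(T)` of a finite set of vertices. This is the topology for
which `Aut(T)`, with its usual topology, is an open subgroup and left translations are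
homeomorphisms. -/
instance hierTopology (T : SimpleGraph V) : TopologicalSpace T.Hier where
  IsOpen U := ∀ g ∈ U, ∃ F : Finset V, ∀ k : T ≃g T, (∀ v ∈ F, k v = v) → g * T.autToHier k ∈ U
  isOpen_univ _ _ := ⟨∅, fun _ _ => Set.mem_univ _⟩
  isOpen_inter U U' hU hU' g hg := by
    classical
    obtain ⟨F, hF⟩ := hU g hg.1
    obtain ⟨F', hF'⟩ := hU' g hg.2
    exact ⟨F ∪ F', fun k hk =>
      ⟨hF k fun v hv => hk v (Finset.mem_union_left _ hv),
        hF' k fun v hv => hk v (Finset.mem_union_right _ hv)⟩⟩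
  isOpen_sUnion S hS g := by
    rintro ⟨U, hU, hg⟩
    obtain ⟨F, hF⟩ := hS U hU g hg
    exact ⟨F, fun k hk => ⟨U, hU, hF k hk⟩⟩

end SimpleGraph

section Representations

variable {G : Type u} [Group G] {H : Type w} [NormedAddCommGroup H] [InnerProductSpace ℂ H]

/-- A unitary representation `ρ` of a topological group in a Hilbert space is a homomorphism to the
unitary group that is continuous in the strong operator topology. -/
def IsStronglyContinuous [TopologicalSpace G] (ρ : G →* (H ≃ₗᵢ[ℂ] H)) : Prop :=
  ∀ v : H, Continuous fun g => ρ g v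

/-- (Topological) irreducibility: the space is nonzero and has no proper nonzero closed invariant
subspaces. -/
def IsIrreducibleUnitary (ρ : G →* (H ≃ₗᵢ[ℂ] H)) : Prop :=
  Nontrivial H ∧ ∀ W : Submodule ℂ H, IsClosed (W : Set H) →
    (∀ g : G, ∀ v ∈ W, ρ g v ∈ W) → W = ⊥ ∨ W = ⊤

/-- The subspace of `K`-fixed vectors. -/
def fixedVectors (ρ : G →* (H ≃ₗᵢ[ℂ] H)) (K : Subgroup G) : Submodule ℂ H where
  carrier := {v | ∀ k ∈ K, ρ k v = v}
  add_mem' ha hb k hk := by rw [map_add, ha k hk, hb k hk]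
  zero_mem' k _ := map_zero _
  smul_mem' c v hv k hk := by rw [map_smul, hv k hk]

end Representations

/-- `K` is a spherical subgroup of `G`: `G` is a topological group, `K` is closed in `G`, and

* in every irreducible unitary representation of `G` the subspace of `K`-fixed vectors has dimension
  at most one;
* there is a faithful unitary representation of `G` and a vector with stabilizer `K`. -/
structure IsSphericalSubgroup (G : Type u) [Group G] [TopologicalSpace G] (K : Subgroup G) :
    Prop where
  isTopologicalGroup : IsTopologicalGroup G
  isClosed : IsClosed (K : Set G)
  rank_fixedVectors_le_one : ∀ (H : Type w) [NormedAddCommGroup H] [InnerProductSpace ℂ H]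
    [CompleteSpace H] (ρ : G →* (H ≃ₗᵢ[ℂ] H)), IsStronglyContinuous ρ → IsIrreducibleUnitary ρ →
      Module.rank ℂ (fixedVectors ρ K) ≤ 1
  exists_faithful : ∃ (H : Type u) (_ : NormedAddCommGroup H) (_ : InnerProductSpace ℂ H)
    (_ : CompleteSpace H) (ρ : G →* (H ≃ₗᵢ[ℂ] H)), IsStronglyContinuous ρ ∧
      Function.Injective ρ ∧ ∃ v : H, ∀ g : G, ρ g v = v ↔ g ∈ K

/-!
Write `G = Hier(T)` and `K = Aut(T)`.

**Topological group.** It has to be shown that conjugation by `g ∈ G` is continuous at the identity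
(`exists_conj_fixes`). Cutting an edge splits an automorphism fixing it into two automorphisms, each
supported in one branch. If conjugation by `g` were discontinuous on the automorphisms supported in
some branch, the same would hold for one of the next smaller branches, and so on along a way; but
near the end of this way `g` coincides with an automorphism `r`, and conjugation by `g` coincides
with conjugation by `r`.

**At most one fixed vector.** Let `P` be the projection to the `K`-fixed vectors of a unitary
representation `ρ`. For an irreducible `ρ` the operators `P ρ(g) P` act irreducibly in the image of
`P`, so it is enough that they commute with each other: then they are normal, and the continuous
functional calculus shows that they are scalars (`rank_fixedVectors_le_one_of_commute`). These
operators depend only on the double coset of `g` with respect to `K`. Every spheromorphism is, up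
to an automorphism, the identity on some ball, and `K` is transitive on the balls; so for given
`g`, `h` one may assume that they are the identity on the two complementary balls cut out by an edge
`(p, q)`. Let `t ∈ K` be a translation that moves this edge forward. Then `t ^ j * h * t ^ (-j)` is
the identity on the same ball as `h`, so it commutes with `g`. Averaging
`ρ(g) ρ(t ^ j) ρ(h)` over `j`, by the mean ergodic theorem one gets `P ρ(g) P ρ(h) P`, provided that
all `t`-fixed vectors are `K`-fixed; so `P ρ(g) P` and `P ρ(h) P` commute.

The latter is the Mautner phenomenon (`rep_apply_eq_of_translation_fixed`). An automorphism fixing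
pointwise the branch attracting `t` (or `t⁻¹`) is contracted to the identity by conjugation with the
powers of `t`, so it fixes all `t`-fixed vectors. Since the vertices have at least three neighbors,
such automorphisms and `t` generate `K`.

**Faithful representation.** The direct sum of the quasi-regular representations in `ℓ²(G ⧸ U)`
over all open subgroups `U` is faithful because the open subgroups intersect in the identity, and
the base point of `G ⧸ K` has stabilizer `K` (`exists_faithful_rep_of_isOpen`).
-/

/-! ### Branches of a tree -/

namespace SimpleGraph

section Branch

variable {V : Type u} {T : SimpleGraph V} {p q r v : V}

theorem IsTree.vertex_induction (hT : T.IsTree) {P : V → Prop} {a : V} (ha : P a)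
    (hstep : ∀ u v, P u → T.Adj u v → P v) (v : V) : P v := by
  obtain ⟨W⟩ := hT.connected a v
  induction W with
  | nil => exact ha
  | cons h _ ih => exact ih (hstep _ _ ha h)

theorem self_mem_branch (p q : V) : q ∈ T.branch p q := Reachable.refl _

theorem mem_branch_of_adj {x y : V} (hx : x ∈ T.branch p q) (hxy : T.Adj x y)
    (hne : s(x, y) ≠ s(p, q)) : y ∈ T.branch p q := by
  refine Reachable.trans hx (Adj.reachable ?_)
  rw [deleteEdges_adj]
  exact ⟨hxy, hne⟩

theorem branch_induction {P : V → Prop} (hq : P q)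
    (hstep : ∀ x y, x ∈ T.branch p q → P x → T.Adj x y → s(x, y) ≠ s(p, q) → P y) :
    ∀ v ∈ T.branch p q, P v := by
  suffices H : ∀ a v, (T.deleteEdges {s(p, q)}).Walk a v → a ∈ T.branch p q → P a → P v from
    fun v ⟨W⟩ => H q v W (self_mem_branch p q) hq
  intro a v W
  induction W with
  | nil => exact fun _ h => h
  | cons h _ ih =>
    intro ha hPa
    rw [deleteEdges_adj] at h
    exact ih (mem_branch_of_adj ha h.1 h.2) (hstep _ _ ha hPa h.1 h.2)

theorem IsTree.notMem_branch (hT : T.IsTree) (h : T.Adj p q) : p ∉ T.branch p q := fun hp =>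
  (isAcyclic_iff_forall_adj_isBridge.mp hT.isAcyclic h) (Reachable.symm hp)

theorem IsTree.mem_branch_or (hT : T.IsTree) (p q v : V) :
    v ∈ T.branch p q ∨ v ∈ T.branch q p := by
  refine hT.vertex_induction (P := fun v => v ∈ T.branch p q ∨ v ∈ T.branch q p)
    (Or.inr (self_mem_branch q p)) (fun x y hx hxy => ?_) v
  by_cases hs : s(x, y) = s(p, q)
  · rcases Sym2.eq_iff.mp hs with ⟨rfl, rfl⟩ | ⟨rfl, rfl⟩
    · exact Or.inl (self_mem_branch _ _)
    · exact Or.inr (self_mem_branch _ _)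
  · rcases hx with hx | hx
    · exact Or.inl (mem_branch_of_adj hx hxy hs)
    · exact Or.inr (mem_branch_of_adj hx hxy (by rwa [Sym2.eq_swap (a := q)]))

theorem IsTree.notMem_branch_of_mem (hT : T.IsTree) (h : T.Adj p q) (hv : v ∈ T.branch p q) :
    v ∉ T.branch q p := by
  intro hv'
  have hv'' : (T.deleteEdges {s(p, q)}).Reachable p v := by
    rw [Sym2.eq_swap]; exact hv'
  exact hT.notMem_branch h (Reachable.trans hv (Reachable.symm hv''))

/-- Branches going in the same direction are nested. -/
theorem IsTree.branch_subset (hT : T.IsTree) (hpq : T.Adj p q) (hqr : T.Adj q r) (hne : r ≠ p) :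
    T.branch q r ⊆ T.branch p q := by
  refine fun v hv => branch_induction (P := fun v => v ∈ T.branch p q) ?_ ?_ v hv
  · refine mem_branch_of_adj (self_mem_branch p q) hqr fun hs => ?_
    rcases Sym2.eq_iff.mp hs with ⟨rfl, rfl⟩ | ⟨-, rfl⟩
    · exact hpq.ne rfl
    · exact hne rfl
  · intro x y hx hxP hxy _
    refine mem_branch_of_adj hxP hxy fun hs => ?_
    rcases Sym2.eq_iff.mp hs with ⟨rfl, rfl⟩ | ⟨rfl, rfl⟩
    · exact hT.notMem_branch hpq hxP
    · exact hT.notMem_branch hqr hx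

theorem IsTree.notMem_branch_sibling (hT : T.IsTree) {r' : V} (hr : T.Adj q r) (hr' : T.Adj q r')
    (hne : r ≠ r') (hv : v ∈ T.branch q r) : v ∉ T.branch q r' := fun hv' =>
  hT.notMem_branch_of_mem hr' hv' (hT.branch_subset hr'.symm hr hne hv)

theorem IsTree.eq_or_mem_child_branch (hT : T.IsTree) (hpq : T.Adj p q) (hv : v ∈ T.branch p q) :
    v = q ∨ ∃ r, T.Adj q r ∧ r ≠ p ∧ v ∈ T.branch q r := by
  refine branch_induction (P := fun v => v = q ∨ ∃ r, T.Adj q r ∧ r ≠ p ∧ v ∈ T.branch q r)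
    (Or.inl rfl) ?_ v hv
  rintro x y hx (rfl | ⟨r, hr, hrp, hxr⟩) hxy hs
  · refine Or.inr ⟨y, hxy, ?_, self_mem_branch _ _⟩
    rintro rfl
    exact hs Sym2.eq_swap
  · by_cases hs' : s(x, y) = s(q, r)
    · rcases Sym2.eq_iff.mp hs' with ⟨rfl, rfl⟩ | ⟨rfl, rfl⟩
      · exact absurd hxr (hT.notMem_branch hr)
      · exact Or.inl rfl
    · exact Or.inr ⟨r, hr, hrp, mem_branch_of_adj hxr hxy hs'⟩

/-- An edge leaving a branch is the edge that was cut. -/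
theorem eq_of_adj_of_mem_of_notMem {x y : V} (hx : x ∈ T.branch p q) (hy : y ∉ T.branch p q)
    (hxy : T.Adj x y) (hT : T.IsTree) (hpq : T.Adj p q) : x = q ∧ y = p := by
  by_cases hs : s(x, y) = s(p, q)
  · rcases Sym2.eq_iff.mp hs with ⟨rfl, rfl⟩ | h
    · exact absurd hx (hT.notMem_branch hpq)
    · exact h
  · exact absurd (mem_branch_of_adj hx hxy hs) hy

theorem map_mem_branch_iff (k : T ≃g T) : k v ∈ T.branch (k p) (k q) ↔ v ∈ T.branch p q := by
  refine ⟨fun h => ?_, map_mem_branch k⟩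
  have := map_mem_branch k⁻¹ h
  have e : ∀ x, k⁻¹ (k x) = x := k.symm_apply_apply
  rwa [e, e, e] at this

/-- An automorphism that fixes the ends of an edge, cut off to one of the two branches: it is
extended by the identity to the other branch. -/
theorem IsTree.exists_cutoff (hT : T.IsTree) (hpq : T.Adj p q) (k : T ≃g T) (hp : k p = p)
    (hq : k q = q) :
    ∃ l : T ≃g T, (∀ v ∈ T.branch p q, l v = k v) ∧ ∀ v, v ∉ T.branch p q → l v = v := by
  classical
  let f : (T ≃g T) → V → V := fun k v => if v ∈ T.branch p q then k v else v
  have f_pos : ∀ (k : T ≃g T) v, v ∈ T.branch p q → f k v = k v := fun k v hv => if_pos hv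
  have f_neg : ∀ (k : T ≃g T) v, v ∉ T.branch p q → f k v = v := fun k v hv => if_neg hv
  have mem : ∀ k : T ≃g T, k p = p → k q = q → ∀ v, k v ∈ T.branch p q ↔ v ∈ T.branch p q := by
    intro k hp hq v
    have := map_mem_branch_iff (p := p) (q := q) (v := v) k
    rwa [hp, hq] at this
  have inv : ∀ k : T ≃g T, k p = p → k q = q → ∀ v, f k⁻¹ (f k v) = v := by
    intro k hp hq v
    by_cases hv : v ∈ T.branch p q
    · rw [f_pos k v hv, f_pos _ _ ((mem k hp hq v).mpr hv)]
      exact k.symm_apply_apply v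
    · rw [f_neg k v hv, f_neg _ _ hv]
  have hom : ∀ k : T ≃g T, k p = p → k q = q → ∀ x y, T.Adj x y → T.Adj (f k x) (f k y) := by
    intro k hp hq x y hxy
    have aux : ∀ x y, T.Adj x y → x ∈ T.branch p q → y ∉ T.branch p q →
        T.Adj (f k x) (f k y) := by
      intro x y hxy hx hy
      obtain ⟨rfl, rfl⟩ := eq_of_adj_of_mem_of_notMem hx hy hxy hT hpq
      rwa [f_pos _ _ hx, f_neg _ _ hy, hq]
    by_cases hx : x ∈ T.branch p q <;> by_cases hy : y ∈ T.branch p q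
    · rw [f_pos _ _ hx, f_pos _ _ hy]
      exact k.map_adj_iff.mpr hxy
    · exact aux x y hxy hx hy
    · exact (aux y x hxy.symm hy hx).symm
    · rwa [f_neg _ _ hx, f_neg _ _ hy]
  have hp' : k⁻¹ p = p := (k.symm_apply_eq).mpr hp.symm
  have hq' : k⁻¹ q = q := (k.symm_apply_eq).mpr hq.symm
  refine ⟨⟨⟨f k, f k⁻¹, inv k hp hq, ?_⟩, ?_⟩, f_pos k, f_neg k⟩
  · intro v
    have := inv k⁻¹ hp' hq' v
    rwa [inv_inv] at this
  · intro x y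
    refine ⟨fun h => ?_, hom k hp hq x y⟩
    have h2 := hom k⁻¹ hp' hq' _ _ h
    have i := inv k hp hq
    simpa only [Equiv.coe_fn_mk, i] using h2

end Branch

/-! ### Homogeneity of the regular tree -/

section Homogeneous

variable {V : Type u} {T : SimpleGraph V} {n : ℕ}

/-- A numbering of the children: for each directed edge `(p, q)` the function `c p q` enumerates
without repetitions the neighbors of `q` distinct from `p`. -/
def IsChildNumbering (T : SimpleGraph V) (c : V → V → Fin n → V) : Prop :=
  ∀ p q, T.Adj p q → Function.Injective (c p q) ∧ ∀ r, (∃ i, c p q i = r) ↔ T.Adj q r ∧ r ≠ p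

/-- The directed edge reached from a directed edge by moving forward, the `i`-th child being taken
as prescribed by the letters of a word. -/
def descend (c : V → V → Fin n → V) : V × V → List (Fin n) → V × V
  | d, [] => d
  | d, i :: l => descend c (d.2, c d.1 d.2 i) l

theorem descend_append (c : V → V → Fin n → V) (d : V × V) (l : List (Fin n)) (i : Fin n) :
    descend c d (l ++ [i]) =
      ((descend c d l).2, c (descend c d l).1 (descend c d l).2 i) := by
  induction l generalizing d with
  | nil => rfl
  | cons j l ih => exact ih _

variable {c : V → V → Fin n → V}

theorem IsChildNumbering.adj_child (hc : IsChildNumbering T c) {p q : V} (h : T.Adj p q)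
    (i : Fin n) : T.Adj q (c p q i) ∧ c p q i ≠ p :=
  ((hc p q h).2 _).mp ⟨i, rfl⟩

theorem IsChildNumbering.adj_descend (hc : IsChildNumbering T c) {d : V × V}
    (h : T.Adj d.1 d.2) (l : List (Fin n)) : T.Adj (descend c d l).1 (descend c d l).2 := by
  induction l generalizing d with
  | nil => exact h
  | cons i l ih => exact ih (d := (d.2, c d.1 d.2 i)) (hc.adj_child h i).1

theorem IsChildNumbering.descend_mem_branch (hT : T.IsTree) (hc : IsChildNumbering T c) {d : V × V}
    (h : T.Adj d.1 d.2) (l : List (Fin n)) : (descend c d l).2 ∈ T.branch d.1 d.2 := by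
  induction l generalizing d with
  | nil => exact self_mem_branch _ _
  | cons i l ih =>
    have hi := hc.adj_child h i
    exact hT.branch_subset h hi.1 hi.2 (ih (d := (d.2, c d.1 d.2 i)) hi.1)

theorem IsChildNumbering.descend_injective (hT : T.IsTree) (hc : IsChildNumbering T c) {d : V × V}
    (h : T.Adj d.1 d.2) {l m : List (Fin n)} (hlm : (descend c d l).2 = (descend c d m).2) :
    l = m := by
  have root : ∀ i l, (descend c d (i :: l)).2 ≠ d.2 := by
    intro i l he
    have hi := hc.adj_child h i
    have := hc.descend_mem_branch hT (d := (d.2, c d.1 d.2 i)) hi.1 l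
    rw [show (descend c (d.2, c d.1 d.2 i) l).2 = d.2 from he] at this
    exact hT.notMem_branch hi.1 this
  induction l generalizing d m with
  | nil =>
    cases m with
    | nil => rfl
    | cons j m => exact absurd hlm.symm (root j m)
  | cons i l ih =>
    cases m with
    | nil => exact absurd hlm (root i l)
    | cons j m =>
      have hi := hc.adj_child h i
      have hj := hc.adj_child h j
      have hij : i = j := by
        by_contra hij
        have h1 := hc.descend_mem_branch hT (d := (d.2, c d.1 d.2 i)) hi.1 l
        have h2 := hc.descend_mem_branch hT (d := (d.2, c d.1 d.2 j)) hj.1 m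
        rw [show (descend c (d.2, c d.1 d.2 i) l).2 = (descend c (d.2, c d.1 d.2 j) m).2 from hlm]
          at h1
        exact hT.notMem_branch_sibling hi.1 hj.1 (fun e => hij ((hc _ _ h).1 e)) h1 h2
      subst hij
      rw [ih (d := (d.2, c d.1 d.2 i)) (m := m) hi.1 hlm]
      intro i' l' he
      have hi' := hc.adj_child (p := d.2) (q := c d.1 d.2 i) hi.1 i'
      have := hc.descend_mem_branch hT (d := (_, c d.2 (c d.1 d.2 i) i')) hi'.1 l'
      rw [show (descend c (_, c d.2 (c d.1 d.2 i) i') l').2 = c d.1 d.2 i from he] at this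
      exact hT.notMem_branch hi'.1 this

/-- The vertex with a given address: the boolean selects one of the two branches at a fixed edge
`(p, q)`, the word describes the descent inside of this branch. -/
def addressVertex (c : V → V → Fin n → V) (p q : V) (x : Bool × List (Fin n)) : V :=
  (descend c (if x.1 then (q, p) else (p, q)) x.2).2

/-- Adjacency in terms of addresses. -/
def AddressAdj (x y : Bool × List (Fin n)) : Prop :=
  (x.1 = y.1 ∧ ((∃ i, y.2 = x.2 ++ [i]) ∨ ∃ i, x.2 = y.2 ++ [i])) ∨
    (x.1 = !y.1 ∧ x.2 = [] ∧ y.2 = [])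

theorem adj_ite {p q : V} (h : T.Adj p q) (b : Bool) :
    T.Adj (if b then (q, p) else (p, q)).1 (if b then (q, p) else (p, q)).2 := by
  cases b
  · exact h
  · exact h.symm

theorem IsChildNumbering.adj_addressVertex (hc : IsChildNumbering T c) {p q : V} (h : T.Adj p q)
    {x y : Bool × List (Fin n)} (hxy : AddressAdj x y) :
    T.Adj (addressVertex c p q x) (addressVertex c p q y) := by
  have child : ∀ b l i, T.Adj (addressVertex c p q (b, l)) (addressVertex c p q (b, l ++ [i])) := by
    intro b l i
    simp only [addressVertex, descend_append]
    exact (hc.adj_child (hc.adj_descend (adj_ite h b) l) i).1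
  obtain ⟨b, l⟩ := x
  obtain ⟨b', l'⟩ := y
  rcases hxy with ⟨h1, ⟨i, h2⟩ | ⟨i, h2⟩⟩ | ⟨h1, h2, h3⟩ <;> dsimp only at h1 h2
  · subst h1 h2
    exact child _ _ _
  · subst h1 h2
    exact (child _ _ _).symm
  · dsimp only at h3
    subst h1 h2 h3
    cases b'
    · simpa [addressVertex, descend] using h
    · simpa [addressVertex, descend] using h.symm

theorem IsChildNumbering.exists_addressAdj (hc : IsChildNumbering T c) {p q : V} (h : T.Adj p q)
    (x : Bool × List (Fin n)) {v : V} (hv : T.Adj (addressVertex c p q x) v) :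
    ∃ y, AddressAdj x y ∧ addressVertex c p q y = v := by
  obtain ⟨b, l⟩ := x
  by_cases hvp : v = (descend c (if b then (q, p) else (p, q)) l).1
  · rcases List.eq_nil_or_concat l with rfl | ⟨m, i, rfl⟩
    · refine ⟨(!b, []), Or.inr ⟨(Bool.not_not b).symm, rfl, rfl⟩, ?_⟩
      rw [hvp]
      cases b <;> rfl
    · refine ⟨(b, m), Or.inl ⟨rfl, Or.inr ⟨i, List.concat_eq_append⟩⟩, ?_⟩
      rw [hvp, List.concat_eq_append, descend_append]
      rfl
  · obtain ⟨i, hi⟩ := ((hc _ _ (hc.adj_descend (adj_ite h b) l)).2 v).mpr ⟨hv, hvp⟩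
    refine ⟨(b, l ++ [i]), Or.inl ⟨rfl, Or.inl ⟨i, rfl⟩⟩, ?_⟩
    simp only [addressVertex, descend_append]
    exact hi

theorem IsChildNumbering.bijective_addressVertex (hT : T.IsTree) (hc : IsChildNumbering T c)
    {p q : V} (h : T.Adj p q) : Function.Bijective (addressVertex c p q) := by
  refine ⟨?_, ?_⟩
  · rintro ⟨b, l⟩ ⟨b', l'⟩ he
    have h1 := hc.descend_mem_branch hT (adj_ite h b) l
    have h2 := hc.descend_mem_branch hT (adj_ite h b') l'
    have he' : (descend c (if b then (q, p) else (p, q)) l).2 =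
      (descend c (if b' then (q, p) else (p, q)) l').2 := he
    have hb : b = b' := by
      rw [he'] at h1
      cases b <;> cases b'
      · rfl
      · exact absurd h2 (hT.notMem_branch_of_mem h h1)
      · exact absurd h1 (hT.notMem_branch_of_mem h h2)
      · rfl
    subst hb
    rw [hc.descend_injective hT (adj_ite h b) he']
  · refine hT.vertex_induction (P := fun v => ∃ x, addressVertex c p q x = v)
      (a := q) ⟨(false, []), rfl⟩ ?_
    rintro _ v ⟨x, rfl⟩ hxv
    obtain ⟨y, -, hy⟩ := hc.exists_addressAdj h x hxv
    exact ⟨y, hy⟩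

theorem IsChildNumbering.adj_addressVertex_iff (hT : T.IsTree) (hc : IsChildNumbering T c)
    {p q : V} (h : T.Adj p q) {x y : Bool × List (Fin n)} :
    T.Adj (addressVertex c p q x) (addressVertex c p q y) ↔ AddressAdj x y := by
  refine ⟨fun hxy => ?_, hc.adj_addressVertex h⟩
  obtain ⟨z, hxz, hz⟩ := hc.exists_addressAdj h x hxy
  rwa [← (hc.bijective_addressVertex hT h).1 hz]

theorem exists_childNumbering (hn : 0 < n) (hdeg : ∀ v : V, (T.neighborSet v).ncard = n + 1)
    {p₀ q₀ r₀ : V} (hpq : T.Adj p₀ q₀) (hqr : T.Adj q₀ r₀) (hne : r₀ ≠ p₀) :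
    ∃ c : V → V → Fin n → V, IsChildNumbering T c ∧ c p₀ q₀ ⟨0, hn⟩ = r₀ := by
  -- Composing an enumeration with a transposition moves `r₀` to the first place.
  have key : ∀ p q, ∃ f : Fin n → V, (T.Adj p q → Function.Injective f ∧
      ∀ r, (∃ i, f i = r) ↔ T.Adj q r ∧ r ≠ p) ∧
      (T.Adj p q → T.Adj q r₀ → r₀ ≠ p → f ⟨0, hn⟩ = r₀) := by
    intro p q
    by_cases hpq : T.Adj p q
    · have hfin : (T.neighborSet q).Finite :=
        Set.finite_of_ncard_ne_zero (by rw [hdeg]; exact Nat.succ_ne_zero n)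
      have hcard : (T.neighborSet q \ {p}).ncard = n := by
        rw [Set.ncard_sdiff_singleton_of_mem (show p ∈ T.neighborSet q from hpq.symm), hdeg]
        rfl
      have : Finite ↑(T.neighborSet q \ {p}) := hfin.sdiff.to_subtype
      let e : ↑(T.neighborSet q \ {p}) ≃ Fin n :=
        (Finite.equivFin _).trans (finCongr (by rw [← hcard]; rfl))
      have aux : ∀ e : ↑(T.neighborSet q \ {p}) ≃ Fin n,
          Function.Injective (fun i => (e.symm i : V)) ∧
          ∀ r, (∃ i, (e.symm i : V) = r) ↔ T.Adj q r ∧ r ≠ p := by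
        intro e
        refine ⟨Subtype.val_injective.comp e.symm.injective, fun r => ⟨?_, fun hr => ?_⟩⟩
        · rintro ⟨i, rfl⟩
          exact (e.symm i).2
        · exact ⟨e ⟨r, hr⟩, by rw [e.symm_apply_apply]⟩
      by_cases hr : T.Adj q r₀ ∧ r₀ ≠ p
      · let e' := e.trans (Equiv.swap (e ⟨r₀, hr⟩) ⟨0, hn⟩)
        refine ⟨fun i => e'.symm i, fun _ => aux e', fun _ _ _ => ?_⟩
        have : e' ⟨r₀, hr⟩ = ⟨0, hn⟩ := Equiv.swap_apply_left _ _
        change ((e'.symm ⟨0, hn⟩ : _) : V) = r₀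
        rw [← this, Equiv.symm_apply_apply]
      · exact ⟨fun i => e.symm i, fun _ => aux e, fun _ h1 h2 => absurd ⟨h1, h2⟩ hr⟩
    · exact ⟨fun _ => p, fun h => absurd h hpq, fun h => absurd h hpq⟩
  choose c hc hc₀ using key
  exact ⟨c, hc, hc₀ p₀ q₀ hpq hqr hne⟩

/-- The automorphism group of a regular tree is transitive on the paths of length two: matching the
addresses with respect to two such paths is an automorphism. -/
theorem IsTree.exists_iso_arc (hT : T.IsTree) (hn : 0 < n)
    (hdeg : ∀ v : V, (T.neighborSet v).ncard = n + 1) {p q r p' q' r' : V}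
    (hpq : T.Adj p q) (hqr : T.Adj q r) (hne : r ≠ p)
    (hpq' : T.Adj p' q') (hqr' : T.Adj q' r') (hne' : r' ≠ p') :
    ∃ k : T ≃g T, k p = p' ∧ k q = q' ∧ k r = r' := by
  obtain ⟨c, hc, hc₀⟩ := exists_childNumbering hn hdeg hpq hqr hne
  obtain ⟨c', hc', hc₀'⟩ := exists_childNumbering hn hdeg hpq' hqr' hne'
  let e := Equiv.ofBijective _ (hc.bijective_addressVertex hT hpq)
  let e' := Equiv.ofBijective _ (hc'.bijective_addressVertex hT hpq')
  have hk : ∀ x, (e.symm.trans e') (addressVertex c p q x) = addressVertex c' p' q' x := fun x =>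
    congrArg e' (e.symm_apply_apply x)
  refine ⟨⟨e.symm.trans e', ?_⟩, hk (true, []), hk (false, []), ?_⟩
  · intro x y
    obtain ⟨x, rfl⟩ := e.surjective x
    obtain ⟨y, rfl⟩ := e.surjective y
    change T.Adj ((e.symm.trans e') (addressVertex c p q x))
      ((e.symm.trans e') (addressVertex c p q y)) ↔
      T.Adj (addressVertex c p q x) (addressVertex c p q y)
    rw [hk, hk, hc.adj_addressVertex_iff hT hpq, hc'.adj_addressVertex_iff hT hpq']
  · have h1 : r = addressVertex c p q (false, [⟨0, hn⟩]) := hc₀.symm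
    have h2 : r' = addressVertex c' p' q' (false, [⟨0, hn⟩]) := hc₀'.symm
    rw [h1, h2]
    exact hk _

theorem exists_adj_ne_ne (hn : 2 ≤ n) (hdeg : ∀ v : V, (T.neighborSet v).ncard = n + 1)
    (v x y : V) : ∃ z, T.Adj v z ∧ z ≠ x ∧ z ≠ y := by
  by_contra! H
  have hsub : T.neighborSet v ⊆ {x, y} := fun z hz => by
    by_cases hzx : z = x
    · exact Or.inl hzx
    · exact Or.inr (H z hz hzx)
  have := (Set.ncard_le_ncard hsub (Set.toFinite _)).trans (Set.ncard_insert_le x {y})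
  rw [hdeg, Set.ncard_singleton] at this
  omega

/-- A translation: an automorphism moving a vertex along an edge `(p, q)` and mapping that edge to
another edge, hence the branch at `(p, q)` into itself. -/
theorem IsTree.exists_translation (hT : T.IsTree) (hn : 2 ≤ n)
    (hdeg : ∀ v : V, (T.neighborSet v).ncard = n + 1) {p q : V} (hpq : T.Adj p q) :
    ∃ t : T ≃g T, t p = q ∧ t q ≠ p := by
  obtain ⟨r, hqr, hrp, -⟩ := exists_adj_ne_ne hn hdeg q p p
  obtain ⟨s, hrs, hsq, -⟩ := exists_adj_ne_ne hn hdeg r q q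
  obtain ⟨t, h1, h2, -⟩ := hT.exists_iso_arc (by omega) hdeg hpq hqr hrp hqr hrs hsq
  exact ⟨t, h1, by rwa [h2]⟩

theorem IsTree.exists_iso_dart (hT : T.IsTree) (hn : 2 ≤ n)
    (hdeg : ∀ v : V, (T.neighborSet v).ncard = n + 1) {p q p' q' : V} (hpq : T.Adj p q)
    (hpq' : T.Adj p' q') : ∃ k : T ≃g T, k p = p' ∧ k q = q' := by
  obtain ⟨r, hqr, hrp, -⟩ := exists_adj_ne_ne hn hdeg q p p
  obtain ⟨r', hqr', hrp', -⟩ := exists_adj_ne_ne hn hdeg q' p' p'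
  obtain ⟨k, h1, h2, -⟩ := hT.exists_iso_arc (by omega) hdeg hpq hqr hrp hpq' hqr' hrp'
  exact ⟨k, h1, h2⟩

/-- Two branches at `o` can be moved one to another by an automorphism that is the identity on any
third branch at `o`. -/
theorem IsTree.exists_iso_fixing_branch (hT : T.IsTree) (hn : 2 ≤ n)
    (hdeg : ∀ v : V, (T.neighborSet v).ncard = n + 1) {o a b c : V} (ha : T.Adj o a)
    (hb : T.Adj o b) (hc : T.Adj o c) (hba : b ≠ a) (hca : c ≠ a) :
    ∃ k : T ≃g T, k o = o ∧ k b = c ∧ ∀ v ∈ T.branch o a, k v = v := by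
  obtain ⟨k, h1, h2, h3⟩ := hT.exists_iso_arc (by omega) hdeg ha.symm hb hba ha.symm hc hca
  obtain ⟨l, hl, hl'⟩ := hT.exists_cutoff ha.symm k h1 h2
  refine ⟨l, ?_, ?_, fun v hv => hl' v (hT.notMem_branch_of_mem ha hv)⟩
  · rw [hl o (self_mem_branch _ _), h2]
  · rw [hl b (hT.branch_subset ha.symm hb hba (self_mem_branch _ _)), h3]

end Homogeneous

end SimpleGraph

/-! ### Ways and balls of the boundary -/

namespace SimpleGraph

variable {V : Type u} {T : SimpleGraph V} {p q : V}

/-- The boundary point represented by a way. -/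
def Way.toAbs (a : T.Way) : T.Abs := Quotient.mk T.waySetoid a

theorem Way.exists_rep (x : T.Abs) : ∃ a : T.Way, a.toAbs = x := Quotient.exists_rep x

theorem Way.toAbs_eq_iff {a b : T.Way} :
    a.toAbs = b.toAbs ↔ ∃ k l : ℕ, ∀ i, a.vertex (i + k) = b.vertex (i + l) :=
  ⟨fun h => Quotient.exact h, fun h => Quotient.sound (s := T.waySetoid) h⟩

/-- The way without its first `m` vertices. -/
def Way.tail (a : T.Way) (m : ℕ) : T.Way where
  vertex i := a.vertex (i + m)
  adj i := by
    rw [Nat.add_right_comm]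
    exact a.adj (i + m)
  ne i := by
    rw [Nat.add_right_comm]
    exact a.ne (i + m)

theorem Way.toAbs_tail (a : T.Way) (m : ℕ) : (a.tail m).toAbs = a.toAbs :=
  Way.toAbs_eq_iff.mpr ⟨0, m, fun _ => rfl⟩

theorem Way.toAbs_mem_absBall_iff {a : T.Way} :
    a.toAbs ∈ T.absBall p q ↔ ∃ m, ∀ i, m ≤ i → a.vertex i ∈ T.branch p q := by
  constructor
  · rintro ⟨b, hb, hba⟩
    obtain ⟨k, l, h⟩ := Way.toAbs_eq_iff.mp (show b.toAbs = a.toAbs from hba)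
    refine ⟨l, fun i hi => ?_⟩
    obtain ⟨j, rfl⟩ := Nat.exists_eq_add_of_le' hi
    rw [← h]
    exact hb _
  · rintro ⟨m, hm⟩
    exact ⟨a.tail m, fun i => hm _ (Nat.le_add_left _ _), a.toAbs_tail m⟩

theorem Way.branch_subset (hT : T.IsTree) (a : T.Way) {i j : ℕ} (hij : i ≤ j) :
    T.branch (a.vertex j) (a.vertex (j + 1)) ⊆ T.branch (a.vertex i) (a.vertex (i + 1)) := by
  induction j, hij using Nat.le_induction with
  | base => exact subset_rfl
  | succ j _ ih => exact (hT.branch_subset (a.adj j) (a.adj (j + 1)) (a.ne j)).trans ih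

theorem Way.vertex_mem_branch (hT : T.IsTree) (a : T.Way) {i j : ℕ} (hij : i < j) :
    a.vertex j ∈ T.branch (a.vertex i) (a.vertex (i + 1)) := by
  obtain ⟨j, rfl⟩ := Nat.exists_eq_add_of_lt hij
  exact a.branch_subset hT (Nat.le_add_right i j) (self_mem_branch _ _)

theorem Way.vertex_injective (hT : T.IsTree) (a : T.Way) : Function.Injective a.vertex := by
  have lt : ∀ i j, i < j → a.vertex i ≠ a.vertex j := fun i j hij he =>
    hT.notMem_branch (a.adj i) (he ▸ a.vertex_mem_branch hT hij)
  intro i j he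
  rcases lt_trichotomy i j with h | h | h
  · exact absurd he (lt i j h)
  · exact h
  · exact absurd he.symm (lt j i h)

theorem Way.toAbs_mem_absBall_self (hT : T.IsTree) (a : T.Way) (i : ℕ) :
    a.toAbs ∈ T.absBall (a.vertex i) (a.vertex (i + 1)) :=
  Way.toAbs_mem_absBall_iff.mpr ⟨i + 1, fun _ hj => a.vertex_mem_branch hT hj⟩

theorem absBall_mono {p' q' : V} (h : T.branch p q ⊆ T.branch p' q') :
    T.absBall p q ⊆ T.absBall p' q' := fun _ ⟨a, ha, hx⟩ => ⟨a, fun i => h (ha i), hx⟩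

theorem IsTree.notMem_absBall_of_mem (hT : T.IsTree) (h : T.Adj p q) {x : T.Abs}
    (hx : x ∈ T.absBall p q) : x ∉ T.absBall q p := by
  obtain ⟨a, rfl⟩ := Way.exists_rep x
  intro hx'
  obtain ⟨m, hm⟩ := Way.toAbs_mem_absBall_iff.mp hx
  obtain ⟨m', hm'⟩ := Way.toAbs_mem_absBall_iff.mp hx'
  exact hT.notMem_branch_of_mem h (hm _ (le_max_left m m')) (hm' _ (le_max_right m m'))

theorem IsTree.mem_absBall_or (hT : T.IsTree) (h : T.Adj p q) (x : T.Abs) :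
    x ∈ T.absBall p q ∨ x ∈ T.absBall q p := by
  obtain ⟨a, rfl⟩ := Way.exists_rep x
  -- After crossing the edge a way never comes back.
  have cross : ∀ {p q : V}, T.Adj p q → ∀ i, a.vertex i ∈ T.branch p q →
      a.vertex (i + 1) ∉ T.branch p q → a.toAbs ∈ T.absBall q p := by
    intro p q h i hi hi'
    obtain ⟨e, e'⟩ := eq_of_adj_of_mem_of_notMem hi hi' (a.adj i) hT h
    have := a.toAbs_mem_absBall_self hT i
    rwa [e, e'] at this
  have main : ∀ {p q : V}, T.Adj p q → a.vertex 0 ∈ T.branch p q →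
      a.toAbs ∈ T.absBall p q ∨ a.toAbs ∈ T.absBall q p := by
    intro p q h h0
    by_cases H : ∃ i, a.vertex i ∈ T.branch p q ∧ a.vertex (i + 1) ∉ T.branch p q
    · obtain ⟨i, hi, hi'⟩ := H
      exact Or.inr (cross h i hi hi')
    · push Not at H
      exact Or.inl (Way.toAbs_mem_absBall_iff.mpr ⟨0, fun i _ => Nat.rec h0 H i⟩)
  rcases hT.mem_branch_or p q (a.vertex 0) with h0 | h0
  · exact main h h0
  · exact (main h.symm h0).symm

theorem IsTree.mem_absBall_swap_iff (hT : T.IsTree) (h : T.Adj p q) {x : T.Abs} :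
    x ∈ T.absBall q p ↔ x ∉ T.absBall p q :=
  ⟨fun hx => hT.notMem_absBall_of_mem h.symm hx, fun hx => (hT.mem_absBall_or h x).resolve_left hx⟩

/-- A way leaves any given vertex behind. -/
theorem Way.exists_notMem_branch (hT : T.IsTree) (a : T.Way) (v : V) :
    ∃ i, v ∉ T.branch (a.vertex i) (a.vertex (i + 1)) := by
  refine hT.vertex_induction
    (P := fun v => ∃ i, v ∉ T.branch (a.vertex i) (a.vertex (i + 1)))
    ⟨0, hT.notMem_branch (a.adj 0)⟩ ?_ v
  rintro u v ⟨i, hi⟩ huv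
  by_cases hv : v ∈ T.branch (a.vertex i) (a.vertex (i + 1))
  · obtain ⟨rfl, -⟩ := eq_of_adj_of_mem_of_notMem hv hi huv.symm hT (a.adj i)
    exact ⟨i + 1, hT.notMem_branch (a.adj (i + 1))⟩
  · exact ⟨i, hv⟩

/-- The balls cut off by the edges of a way form a base of neighborhoods of its end. -/
theorem Way.exists_absBall_subset (hT : T.IsTree) (a : T.Way) {N : Set T.Abs}
    (hN : N ∈ 𝓝 a.toAbs) : ∃ i, T.absBall (a.vertex i) (a.vertex (i + 1)) ⊆ N := by
  let B : ℕ → Set T.Abs := fun i => T.absBall (a.vertex i) (a.vertex (i + 1))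
  have hdir : Directed (· ≥ ·) fun i => Filter.principal (B i) := by
    refine Antitone.directed_ge fun i j hij => ?_
    exact Filter.principal_mono.mpr (absBall_mono (a.branch_subset hT hij))
  have hle : Filter.Tendsto id (⨅ i, Filter.principal (B i)) (𝓝 a.toAbs) := by
    refine TopologicalSpace.tendsto_nhds_generateFrom_iff.mpr ?_
    rintro _ ⟨p, q, hpq, rfl⟩ ha
    obtain ⟨m, hm⟩ := Way.toAbs_mem_absBall_iff.mp ha
    obtain ⟨i, hi⟩ := a.exists_notMem_branch hT p
    refine (Filter.mem_iInf_of_directed hdir _).mpr ⟨max i m, ?_⟩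
    -- The branch beyond the edge number `max i m` begins in the given branch and does not contain
    -- `p`, so it cannot leave that branch.
    refine absBall_mono fun v hv => ?_
    refine branch_induction (P := fun v => v ∈ T.branch p q)
      (hm _ ((le_max_right i m).trans (Nat.le_succ _))) (fun x y hx hxP hxy hs => ?_) v hv
    by_contra hy
    obtain ⟨-, rfl⟩ := eq_of_adj_of_mem_of_notMem hxP hy hxy hT hpq
    exact hi (a.branch_subset hT (le_max_left i m) (mem_branch_of_adj hx hxy hs))
  exact (Filter.mem_iInf_of_directed hdir _).mp (hle hN)

/-- Distinct points of the boundary are separated by a ball. -/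
theorem IsTree.exists_absBall_separating (hT : T.IsTree) {x y : T.Abs} (hxy : x ≠ y) :
    ∃ p q, T.Adj p q ∧ x ∈ T.absBall p q ∧ y ∉ T.absBall p q := by
  obtain ⟨a, rfl⟩ := Way.exists_rep x
  obtain ⟨b, rfl⟩ := Way.exists_rep y
  by_contra! H
  refine hxy ?_
  have hb := fun i => H _ _ (a.adj i) (a.toAbs_mem_absBall_self hT i)
  obtain ⟨i₀, hi₀⟩ := a.exists_notMem_branch hT (b.vertex 0)
  -- Beginning from the moment `i₀` the way `b` has to cross all edges of the way `a`.
  have cross : ∀ i, i₀ ≤ i →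
      ∃ m, b.vertex m = a.vertex i ∧ b.vertex (m + 1) = a.vertex (i + 1) := by
    intro i hi
    by_contra! Hc
    obtain ⟨m, hm⟩ := Way.toAbs_mem_absBall_iff.mp (hb i)
    have out : ∀ j, b.vertex j ∉ T.branch (a.vertex i) (a.vertex (i + 1)) := by
      intro j
      induction j with
      | zero => exact fun h => hi₀ (a.branch_subset hT hi h)
      | succ j ih =>
        intro hj
        obtain ⟨e, e'⟩ := eq_of_adj_of_mem_of_notMem hj ih (b.adj j).symm hT (a.adj i)
        exact Hc j e' e
    exact out m (hm m le_rfl)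
  obtain ⟨m, hm, -⟩ := cross i₀ le_rfl
  have follow : ∀ j, b.vertex (j + m) = a.vertex (j + i₀) := by
    intro j
    induction j with
    | zero => rw [Nat.zero_add, Nat.zero_add, hm]
    | succ j ih =>
      obtain ⟨m', h1, h2⟩ := cross (j + i₀) (Nat.le_add_left _ _)
      have : m' = j + m := b.vertex_injective hT (h1.trans ih.symm)
      rw [Nat.add_right_comm, Nat.add_right_comm j 1 i₀, ← h2, this]
  exact Way.toAbs_eq_iff.mpr ⟨i₀, m, fun j => (follow j).symm⟩

/-! ### The action of automorphisms on the boundary -/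

theorem absHomeo_mem_absBall_iff (k : T ≃g T) {x : T.Abs} :
    T.absHomeo k x ∈ T.absBall (k p) (k q) ↔ x ∈ T.absBall p q := by
  refine ⟨fun h => ?_, absMap_mem_absBall k⟩
  have := absMap_mem_absBall k⁻¹ h
  have e : ∀ x, k⁻¹ (k x) = x := k.symm_apply_apply
  rw [e, e] at this
  rwa [← absMap_inv_absMap k x]

theorem absHomeo_mem_absBall_iff_of_fixed {k : T ≃g T} (hp : k p = p) (hq : k q = q) {x : T.Abs} :
    T.absHomeo k x ∈ T.absBall p q ↔ x ∈ T.absBall p q := by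
  have := absHomeo_mem_absBall_iff (p := p) (q := q) (x := x) k
  rwa [hp, hq] at this

theorem absHomeo_eq_self {k : T ≃g T} (h : ∀ v ∈ T.branch p q, k v = v) {x : T.Abs}
    (hx : x ∈ T.absBall p q) : T.absHomeo k x = x := by
  obtain ⟨a, ha, rfl⟩ := hx
  exact Way.toAbs_eq_iff.mpr ⟨0, 0, fun i => h _ (ha i)⟩

/-- The way of iterates of a vertex under a translation. -/
def translationWay (t : T ≃g T) (h : T.Adj p (t p)) (hne : t (t p) ≠ p) : T.Way where
  vertex i := (t ^ i) p
  adj i := by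
    rw [pow_succ]
    exact (t ^ i).map_adj_iff.mpr h
  ne i := by
    rw [pow_add, pow_two]
    exact fun e => hne ((t ^ i).injective e)

end SimpleGraph

/-! ### The topological group of spheromorphisms -/

namespace SimpleGraph

variable {V : Type u} {T : SimpleGraph V} {p q : V} {n : ℕ}

/-- The homeomorphism of the boundary underlying a spheromorphism. -/
def Hier.toHomeo (T : SimpleGraph V) : T.Hier →* (T.Abs ≃ₜ T.Abs) := T.spheromorphisms.subtype

theorem Hier.toHomeo_injective : Function.Injective (Hier.toHomeo T) :=
  T.spheromorphisms.subtype_injective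

theorem Hier.ext {g h : T.Hier} (H : ∀ x, Hier.toHomeo T g x = Hier.toHomeo T h x) : g = h :=
  Hier.toHomeo_injective (Homeomorph.ext H)

theorem Hier.toHomeo_mul_apply (g h : T.Hier) (x : T.Abs) :
    Hier.toHomeo T (g * h) x = Hier.toHomeo T g (Hier.toHomeo T h x) := rfl

theorem Hier.toHomeo_autToHier (k : T ≃g T) : Hier.toHomeo T (T.autToHier k) = T.absHomeo k := rfl

theorem Hier.exists_eq_absHomeo_on (g : T.Hier) (y : T.Abs) :
    ∃ N ∈ 𝓝 y, ∃ r : T ≃g T, ∀ x ∈ N, Hier.toHomeo T g x = T.absHomeo r x := g.2 y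

/-- Conjugation by `g` carries the automorphisms that are supported in `C` and fix a suitable finite
set of vertices to automorphisms fixing `F`. -/
def ConjFixes (g : T.Hier) (F : Finset V) (C : Set V) : Prop :=
  ∃ F' : Finset V, ∀ k : T ≃g T, (∀ v ∈ F', k v = v) → (∀ v, v ∉ C → k v = v) →
    ∃ k' : T ≃g T, (∀ v ∈ F, k' v = v) ∧ g * T.autToHier k * g⁻¹ = T.autToHier k'

theorem ConjFixes.mono {g : T.Hier} {F : Finset V} {C D : Set V} (h : ConjFixes g F D)
    (hCD : C ⊆ D) : ConjFixes g F C := by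
  obtain ⟨F', hF'⟩ := h
  exact ⟨F', fun k hk hkC => hF' k hk fun v hv => hkC v fun h => hv (hCD h)⟩

theorem conjFixes_singleton (g : T.Hier) (F : Finset V) (v : V) : ConjFixes g F {v} := by
  refine ⟨{v}, fun k hk hkC => ⟨1, fun _ _ => rfl, ?_⟩⟩
  have : k = 1 := by
    ext x
    by_cases hx : x = v
    · exact hk x (Finset.mem_singleton.mpr hx)
    · exact hkC x hx
  rw [this, map_one, mul_one, mul_inv_cancel]

theorem ConjFixes.branch_union (hT : T.IsTree) (h : T.Adj p q) {g : T.Hier} {F : Finset V}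
    {C : Set V} (hpq : ConjFixes g F (T.branch p q)) (hC : ConjFixes g F C) :
    ConjFixes g F (T.branch p q ∪ C) := by
  classical
  obtain ⟨F₁, hF₁⟩ := hpq
  obtain ⟨F₂, hF₂⟩ := hC
  refine ⟨F₁ ∪ F₂ ∪ {p, q}, fun k hk hkC => ?_⟩
  have hk₁ : ∀ v ∈ F₁, k v = v := fun v hv => hk v (by simp [hv])
  have hk₂ : ∀ v ∈ F₂, k v = v := fun v hv => hk v (by simp [hv])
  have hp : k p = p := hk p (by simp)
  have hq : k q = q := hk q (by simp)
  obtain ⟨l, hl, hl'⟩ := hT.exists_cutoff h k hp hq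
  have hlk : ∀ v, k v = v → l v = v := by
    intro v hv
    by_cases hv' : v ∈ T.branch p q
    · rw [hl v hv', hv]
    · exact hl' v hv'
  have hinv : ∀ v w, l w = v → l⁻¹ v = w := fun v w hvw => l.symm_apply_eq.mpr hvw.symm
  have hlk' : ∀ v, k v = v → (l⁻¹ * k) v = v := by
    intro v hv
    change l⁻¹ (k v) = v
    rw [hv]
    exact hinv v v (hlk v hv)
  obtain ⟨m₁, hm₁, e₁⟩ := hF₁ l (fun v hv => hlk v (hk₁ v hv)) hl'
  obtain ⟨m₂, hm₂, e₂⟩ := hF₂ (l⁻¹ * k) (fun v hv => hlk' v (hk₂ v hv)) fun v hv => by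
    by_cases hv' : v ∈ T.branch p q
    · exact hinv _ _ (hl v hv')
    · exact hlk' v (hkC v (by simp [hv, hv']))
  refine ⟨m₁ * m₂, fun v hv => ?_, ?_⟩
  · change m₁ (m₂ v) = v
    rw [hm₂ v hv, hm₁ v hv]
  · rw [map_mul, ← e₁, ← e₂, map_mul, map_inv]
    group

theorem ConjFixes.branch_of_children (hT : T.IsTree) (hfin : (T.neighborSet q).Finite)
    (hpq : T.Adj p q) {g : T.Hier} {F : Finset V}
    (h : ∀ r, T.Adj q r → r ≠ p → ConjFixes g F (T.branch q r)) :
    ConjFixes g F (T.branch p q) := by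
  classical
  have key : ∀ R : Finset V, (∀ r ∈ R, T.Adj q r ∧ r ≠ p) →
      ConjFixes g F ({v | ∃ r ∈ R, v ∈ T.branch q r} ∪ {q}) := by
    intro R
    induction R using Finset.induction_on with
    | empty => exact fun _ => (conjFixes_singleton g F q).mono (by simp)
    | insert r R _ ih =>
      intro hR
      have hr := hR r (Finset.mem_insert_self r R)
      refine ((h r hr.1 hr.2).branch_union hT hr.1
        (ih fun s hs => hR s (Finset.mem_insert_of_mem hs))).mono ?_
      rintro v (⟨s, hs, hv⟩ | hv)
      · rcases Finset.mem_insert.mp hs with rfl | hs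
        · exact Or.inl hv
        · exact Or.inr (Or.inl ⟨s, hs, hv⟩)
      · exact Or.inr (Or.inr hv)
  refine (key (hfin.toFinset.erase p) fun r hr => ?_).mono fun v hv => ?_
  · rw [Finset.mem_erase, Set.Finite.mem_toFinset] at hr
    exact ⟨hr.2, hr.1⟩
  · rcases hT.eq_or_mem_child_branch hpq hv with rfl | ⟨r, hr, hrp, hvr⟩
    · exact Or.inr rfl
    · exact Or.inl ⟨r, Finset.mem_erase.mpr ⟨hrp, hfin.mem_toFinset.mpr hr⟩, hvr⟩

/-- If `g` coincides with an automorphism `r` on a ball, then conjugation by `g` and by `r` agree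
on the automorphisms supported in the corresponding branch. -/
theorem conjFixes_of_eq_absHomeo (hT : T.IsTree) (hpq : T.Adj p q) {g : T.Hier} (F : Finset V)
    {r : T ≃g T} (hr : ∀ x ∈ T.absBall p q, Hier.toHomeo T g x = T.absHomeo r x) :
    ConjFixes g F (T.branch p q) := by
  classical
  refine ⟨F.image (fun v => r⁻¹ v) ∪ {p, q}, fun k hk hkC => ⟨r * k * r⁻¹, fun v hv => ?_, ?_⟩⟩
  · change r (k (r⁻¹ v)) = v
    rw [hk _ (Finset.mem_union_left _ (Finset.mem_image_of_mem _ hv))]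
    exact r.apply_symm_apply v
  · have hp : k p = p := hk p (by simp)
    have hq : k q = q := hk q (by simp)
    rw [mul_inv_eq_iff_eq_mul]
    refine Hier.ext fun x => ?_
    rw [Hier.toHomeo_mul_apply, Hier.toHomeo_mul_apply, Hier.toHomeo_autToHier,
      Hier.toHomeo_autToHier, map_mul, map_mul]
    change _ = T.absHomeo r (T.absHomeo k (T.absHomeo r⁻¹ (Hier.toHomeo T g x)))
    by_cases hx : x ∈ T.absBall p q
    · rw [hr x hx, hr _ ((absHomeo_mem_absBall_iff_of_fixed hp hq).mpr hx)]
      congr 2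
      exact (absMap_inv_absMap r x).symm
    · have out : ∀ z, z ∉ T.absBall p q → T.absHomeo k z = z := fun z hz =>
        absHomeo_eq_self (fun v hv => hkC v (hT.notMem_branch_of_mem hpq.symm hv))
          ((hT.mem_absBall_swap_iff hpq).mpr hz)
      have hz : T.absHomeo r⁻¹ (Hier.toHomeo T g x) ∉ T.absBall p q := by
        intro hz
        have h1 := hr _ hz
        rw [show T.absHomeo r (T.absHomeo r⁻¹ (Hier.toHomeo T g x)) = Hier.toHomeo T g x from
          absMap_absMap_inv r _] at h1
        rw [(Hier.toHomeo T g).injective h1] at hz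
        exact hx hz
      rw [out x hx, out _ hz]
      exact (absMap_absMap_inv r _).symm

/-- If the claim failed for a branch, it would fail for one of the branches next to it, and so on
along a way; but near the end of this way `g` coincides with an automorphism. -/
theorem conjFixes_branch (hT : T.IsTree) (hfin : ∀ v, (T.neighborSet v).Finite) (hpq : T.Adj p q)
    (g : T.Hier) (F : Finset V) : ConjFixes g F (T.branch p q) := by
  by_contra hbad
  let Bad : Type u := {d : V × V // T.Adj d.1 d.2 ∧ ¬ ConjFixes g F (T.branch d.1 d.2)}
  have hnext : ∀ d : Bad, ∃ e : Bad, e.1.1 = d.1.2 ∧ e.1.2 ≠ d.1.1 := by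
    rintro ⟨⟨x, y⟩, hxy, hb⟩
    by_contra! H
    refine hb (ConjFixes.branch_of_children hT (hfin y) hxy fun r hr hrx => ?_)
    by_contra hr'
    exact hrx (H ⟨(y, r), hr, hr'⟩ rfl)
  choose next hnext₁ hnext₂ using hnext
  let d : ℕ → Bad := fun i => next^[i] ⟨(p, q), hpq, hbad⟩
  have hd : ∀ i, d (i + 1) = next (d i) := fun i => Function.iterate_succ_apply' _ _ _
  have hd₁ : ∀ i, (d (i + 1)).1.1 = (d i).1.2 := fun i => by rw [hd, hnext₁]
  let a : T.Way :=
    { vertex := fun i => (d i).1.1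
      adj := fun i => by
        rw [hd₁]
        exact (d i).2.1
      ne := fun i => by
        rw [hd₁, hd]
        exact hnext₂ _ }
  obtain ⟨N, hN, r, hr⟩ := g.exists_eq_absHomeo_on a.toAbs
  obtain ⟨i, hi⟩ := a.exists_absBall_subset hT hN
  have hgood := conjFixes_of_eq_absHomeo hT (a.adj i) F fun x hx => hr x (hi hx)
  have e : a.vertex (i + 1) = (d i).1.2 := hd₁ i
  rw [e] at hgood
  exact (d i).2.2 hgood

theorem exists_conj_fixes (hT : T.IsTree) (hfin : ∀ v, (T.neighborSet v).Finite) (hpq : T.Adj p q)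
    (g : T.Hier) (F : Finset V) :
    ∃ F' : Finset V, ∀ k : T ≃g T, (∀ v ∈ F', k v = v) →
      ∃ k' : T ≃g T, (∀ v ∈ F, k' v = v) ∧ g * T.autToHier k * g⁻¹ = T.autToHier k' := by
  obtain ⟨F', hF'⟩ := (conjFixes_branch hT hfin hpq g F).branch_union hT hpq
    (conjFixes_branch hT hfin hpq.symm g F)
  exact ⟨F', fun k hk => hF' k hk fun v hv => absurd (hT.mem_branch_or p q v) hv⟩

/-- The pointwise stabilizer of a finite set of vertices, as a subgroup of `Hier(T)`. -/
def fixatorSubgroup (T : SimpleGraph V) (F : Finset V) : Subgroup T.Hier where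
  carrier := {g | ∃ k : T ≃g T, (∀ v ∈ F, k v = v) ∧ T.autToHier k = g}
  one_mem' := ⟨1, fun _ _ => rfl, map_one _⟩
  mul_mem' := by
    rintro _ _ ⟨k, hk, rfl⟩ ⟨l, hl, rfl⟩
    exact ⟨k * l, fun v hv => (congrArg k (hl v hv)).trans (hk v hv), map_mul _ _ _⟩
  inv_mem' := by
    rintro _ ⟨k, hk, rfl⟩
    exact ⟨k⁻¹, fun v hv => k.symm_apply_eq.mpr (hk v hv).symm, map_inv _ _⟩

theorem Hier.mem_nhds_iff {g : T.Hier} {U : Set T.Hier} :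
    U ∈ 𝓝 g ↔ ∃ F : Finset V, ∀ s ∈ fixatorSubgroup T F, g * s ∈ U := by
  constructor
  · intro h
    obtain ⟨O, hOU, hO, hgO⟩ := _root_.mem_nhds_iff.mp h
    obtain ⟨F, hF⟩ := hO g hgO
    refine ⟨F, ?_⟩
    rintro _ ⟨k, hk, rfl⟩
    exact hOU (hF k hk)
  · rintro ⟨F, hF⟩
    refine _root_.mem_nhds_iff.mpr ⟨{x | ∃ s ∈ fixatorSubgroup T F, g * s = x}, ?_, ?_, ?_⟩
    · rintro _ ⟨s, hs, rfl⟩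
      exact hF s hs
    · rintro _ ⟨s, hs, rfl⟩
      exact ⟨F, fun k hk => ⟨s * T.autToHier k,
        mul_mem hs ⟨k, hk, rfl⟩, (mul_assoc _ _ _).symm⟩⟩
    · exact ⟨1, one_mem _, mul_one g⟩

theorem isOpen_of_fixatorSubgroup_le {U : Subgroup T.Hier} {F : Finset V}
    (h : fixatorSubgroup T F ≤ U) : IsOpen (U : Set T.Hier) := by
  rw [isOpen_iff_mem_nhds]
  exact fun g hg => Hier.mem_nhds_iff.mpr ⟨F, fun s hs => mul_mem hg (h hs)⟩

theorem isOpen_autSubgroup : IsOpen (T.autSubgroup : Set T.Hier) :=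
  isOpen_of_fixatorSubgroup_le (F := ∅) (by rintro _ ⟨k, -, rfl⟩; exact ⟨k, rfl⟩)

theorem isTopologicalGroup_hier (hT : T.IsTree) (hfin : ∀ v, (T.neighborSet v).Finite)
    (hpq : T.Adj p q) : IsTopologicalGroup T.Hier := by
  have conj : ∀ (g : T.Hier) (F : Finset V), ∃ F' : Finset V, ∀ s ∈ fixatorSubgroup T F',
      g * s * g⁻¹ ∈ fixatorSubgroup T F := by
    intro g F
    obtain ⟨F', hF'⟩ := exists_conj_fixes hT hfin hpq g F
    refine ⟨F', ?_⟩
    rintro _ ⟨k, hk, rfl⟩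
    obtain ⟨k', hk', e⟩ := hF' k hk
    exact ⟨k', hk', e.symm⟩
  have hmul : ContinuousMul T.Hier := by
    refine ⟨continuous_iff_continuousAt.mpr ?_⟩
    rintro ⟨g, h⟩ W hW
    obtain ⟨F, hF⟩ := Hier.mem_nhds_iff.mp hW
    obtain ⟨F', hF'⟩ := conj h⁻¹ F
    rw [Filter.mem_map, mem_nhds_prod_iff]
    refine ⟨_, Hier.mem_nhds_iff.mpr ⟨F', fun s hs => Set.mem_image_of_mem (g * ·) hs⟩,
      _, Hier.mem_nhds_iff.mpr ⟨F, fun s hs => Set.mem_image_of_mem (h * ·) hs⟩, ?_⟩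
    rintro ⟨_, _⟩ ⟨⟨s, hs, rfl⟩, ⟨s', hs', rfl⟩⟩
    have := hF _ (mul_mem (hF' s hs) hs')
    have e : g * h * (h⁻¹ * s * h⁻¹⁻¹ * s') = g * s * (h * s') := by group
    rw [e] at this
    exact this
  have hinv : ContinuousInv T.Hier := by
    refine ⟨continuous_iff_continuousAt.mpr fun g W hW => ?_⟩
    obtain ⟨F, hF⟩ := Hier.mem_nhds_iff.mp hW
    obtain ⟨F', hF'⟩ := conj g F
    refine Filter.mem_map.mpr (Hier.mem_nhds_iff.mpr ⟨F', fun s hs => ?_⟩)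
    have := hF _ (hF' _ (inv_mem hs))
    rwa [show g⁻¹ * (g * s⁻¹ * g⁻¹) = (g * s)⁻¹ by group] at this
  exact {}

end SimpleGraph

/-! ### Commuting compressions of an irreducible representation -/

section Operators

open scoped InnerProductSpace

variable {M : Type w} [NormedAddCommGroup M] [InnerProductSpace ℂ M] [CompleteSpace M]

/-- A normal operator that is not a scalar has a nontrivial closed subspace invariant under all
operators that commute with it and with its adjoint. Such a subspace is the kernel of `cfc f A`,
where `f` is a continuous function that vanishes near one point of the spectrum but not at
another one. -/
theorem exists_invariant_of_not_scalar [Nontrivial M] (A : M →L[ℂ] M) [hA : IsStarNormal A]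
    (hscalar : ∀ c : ℂ, A ≠ algebraMap ℂ (M →L[ℂ] M) c) :
    ∃ W : Submodule ℂ M, IsClosed (W : Set M) ∧ W ≠ ⊥ ∧ W ≠ ⊤ ∧
      ∀ B : M →L[ℂ] M, Commute A B → Commute (star A) B → ∀ v ∈ W, B v ∈ W := by
  obtain ⟨a, ha⟩ := spectrum.nonempty A
  have hb : ∃ b ∈ spectrum ℂ A, b ≠ a := by
    by_contra! H
    refine hscalar a ?_
    rw [← cfc_const a A, ← cfc_id' ℂ A]
    conv_rhs => rw [cfc_id' ℂ A]
    exact cfc_congr fun x hx => H x hx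
  obtain ⟨b, hb, hba⟩ := hb
  let r : ℝ := dist a b / 2
  have hr : 0 < r := half_pos (dist_pos.mpr hba.symm)
  let f : ℂ → ℂ → ℂ := fun c z => ((max 0 (r - dist z c) : ℝ) : ℂ)
  have hf : ∀ c, Continuous (f c) := fun c => by fun_prop
  have hne : ∀ c ∈ spectrum ℂ A, cfc (f c) A ≠ 0 := by
    intro c hc h0
    have h1 : f c c ∈ spectrum ℂ (cfc (f c) A) := by
      rw [cfc_map_spectrum (f c) A hA (hf c).continuousOn]
      exact ⟨c, hc, rfl⟩
    rw [h0, spectrum.zero_eq, Set.mem_singleton_iff] at h1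
    have h2 : max 0 (r - dist c c) = 0 := Complex.ofReal_eq_zero.mp h1
    rw [dist_self, sub_zero, max_eq_right hr.le] at h2
    exact hr.ne' h2
  have hmul : cfc (f b) A * cfc (f a) A = 0 := by
    rw [← cfc_mul (f b) (f a) A (hf b).continuousOn (hf a).continuousOn]
    have : (fun z => f b z * f a z) = fun _ => 0 := by
      funext z
      rw [mul_eq_zero, Complex.ofReal_eq_zero, Complex.ofReal_eq_zero]
      by_contra! H
      have h1 : dist z b < r := by
        by_contra! h
        exact H.1 (max_eq_left (by linarith))
      have h2 : dist z a < r := by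
        by_contra! h
        exact H.2 (max_eq_left (by linarith))
      have h3 := dist_triangle_left a b z
      have h4 : dist a b = 2 * r := by ring
      linarith
    rw [this, cfc_const_zero]
  refine ⟨(cfc (f b) A).ker, (cfc (f b) A).isClosed_ker, ?_, ?_, ?_⟩
  · intro hbot
    refine hne a ha (ContinuousLinearMap.ext fun v => ?_)
    have : cfc (f a) A v ∈ (cfc (f b) A).ker := DFunLike.congr_fun hmul v
    rw [hbot] at this
    exact this
  · intro htop
    refine hne b hb (ContinuousLinearMap.ext fun v => ?_)
    have : v ∈ (cfc (f b) A).ker := htop ▸ Submodule.mem_top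
    exact this
  · intro B hB hB' v hv
    have hv' : cfc (f b) A v = 0 := hv
    have h1 : cfc (f b) A (B v) = B (cfc (f b) A v) :=
      DFunLike.congr_fun (hB.cfc hB' (f b)).eq v
    change cfc (f b) A (B v) = 0
    rw [h1, hv', map_zero]

/-- Schur's lemma for a commuting self-adjoint family of operators. -/
theorem rank_le_one_of_commuting_irreducible {ι : Type*} (A : ι → M →L[ℂ] M)
    (hstar : ∀ i, ∃ j, star (A i) = A j) (hcomm : ∀ i j, Commute (A i) (A j))
    (hirr : ∀ W : Submodule ℂ M, IsClosed (W : Set M) → (∀ i, ∀ v ∈ W, A i v ∈ W) →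
      W = ⊥ ∨ W = ⊤) : Module.rank ℂ M ≤ 1 := by
  rcases subsingleton_or_nontrivial M with hM | hM
  · rw [rank_subsingleton']
    exact zero_le_one
  have hscalar : ∀ i, ∃ c : ℂ, A i = algebraMap ℂ (M →L[ℂ] M) c := by
    intro i
    by_contra! H
    obtain ⟨j, hj⟩ := hstar i
    have : IsStarNormal (A i) := ⟨hj ▸ hcomm j i⟩
    obtain ⟨W, hW, hbot, htop, hinv⟩ := exists_invariant_of_not_scalar (A i) H
    rcases hirr W hW fun k v hv => hinv (A k) (hcomm i k) (hj ▸ hcomm j k) v hv with h | h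
    · exact hbot h
    · exact htop h
  obtain ⟨v, hv⟩ := exists_ne (0 : M)
  rcases hirr (ℂ ∙ v) (Submodule.closed_of_finiteDimensional _) fun i x hx => by
      obtain ⟨c, hc⟩ := hscalar i
      rw [hc]
      exact Submodule.smul_mem _ c hx with h | h
  · exact absurd (Submodule.span_singleton_eq_bot.mp h) hv
  · refine rank_le_one_iff.mpr ⟨v, fun x => ?_⟩
    have hx : x ∈ (ℂ ∙ v) := h ▸ Submodule.mem_top
    exact Submodule.mem_span_singleton.mp hx

end Operators

section Compression

open scoped InnerProductSpace

variable {G : Type u} [Group G] {H : Type w} [NormedAddCommGroup H] [InnerProductSpace ℂ H]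

theorem isClosed_fixedVectors (ρ : G →* (H ≃ₗᵢ[ℂ] H)) (K : Subgroup G) :
    IsClosed (fixedVectors ρ K : Set H) := by
  have : (fixedVectors ρ K : Set H) = ⋂ k ∈ K, {v | ρ k v = v} := by
    ext v
    simp [fixedVectors]
  rw [this]
  exact isClosed_biInter fun k _ => isClosed_eq (ρ k).continuous continuous_id

theorem rep_mul_apply (ρ : G →* (H ≃ₗᵢ[ℂ] H)) (g h : G) (x : H) :
    ρ (g * h) x = ρ g (ρ h x) := by
  rw [map_mul]
  rfl

theorem rep_one_apply (ρ : G →* (H ≃ₗᵢ[ℂ] H)) (x : H) : ρ 1 x = x := by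
  rw [map_one]
  rfl

theorem inner_rep_left (ρ : G →* (H ≃ₗᵢ[ℂ] H)) (g : G) (x y : H) :
    ⟪ρ g x, y⟫_ℂ = ⟪x, ρ g⁻¹ y⟫_ℂ := by
  rw [← (ρ g⁻¹).inner_map_map (ρ g x) y, ← rep_mul_apply, inv_mul_cancel, rep_one_apply]

variable [CompleteSpace H]

instance completeSpace_fixedVectors (ρ : G →* (H ≃ₗᵢ[ℂ] H)) (K : Subgroup G) :
    CompleteSpace (fixedVectors ρ K) :=
  (isClosed_fixedVectors ρ K).completeSpace_coe

/-- The compression of the operator `ρ g` to the space of the `K`-fixed vectors. -/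
noncomputable def compression (ρ : G →* (H ≃ₗᵢ[ℂ] H)) (K : Subgroup G) (g : G) :
    fixedVectors ρ K →L[ℂ] fixedVectors ρ K :=
  (fixedVectors ρ K).orthogonalProjectionOnto ∘L (ρ g).toContinuousLinearEquiv.toContinuousLinearMap
    ∘L (fixedVectors ρ K).subtypeL

theorem inner_compression_left (ρ : G →* (H ≃ₗᵢ[ℂ] H)) (K : Subgroup G) (g : G)
    (v w : fixedVectors ρ K) : ⟪compression ρ K g v, w⟫_ℂ = ⟪ρ g v, (w : H)⟫_ℂ :=
  (fixedVectors ρ K).inner_orthogonalProjectionOnto_eq_of_mem_right w (ρ g v)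

theorem star_compression (ρ : G →* (H ≃ₗᵢ[ℂ] H)) (K : Subgroup G) (g : G) :
    star (compression ρ K g) = compression ρ K g⁻¹ := by
  rw [ContinuousLinearMap.star_eq_adjoint]
  refine ((ContinuousLinearMap.eq_adjoint_iff _ _).mpr fun v w => ?_).symm
  rw [inner_compression_left, inner_rep_left, inv_inv, ← inner_conj_symm,
    ← inner_compression_left, inner_conj_symm]

theorem eq_bot_or_eq_top_of_compression_invariant {ρ : G →* (H ≃ₗᵢ[ℂ] H)}
    (hρ : IsIrreducibleUnitary ρ) (K : Subgroup G) (W : Submodule ℂ (fixedVectors ρ K))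
    (hW : IsClosed (W : Set (fixedVectors ρ K)))
    (hinv : ∀ g, ∀ v ∈ W, compression ρ K g v ∈ W) : W = ⊥ ∨ W = ⊤ := by
  -- The orthogonal complement of the subrepresentation generated by `W`.
  let Z : Submodule ℂ H :=
    { carrier := {x | ∀ g, ∀ v ∈ W, ⟪ρ g (v : H), x⟫_ℂ = 0}
      add_mem' := fun hx hy g v hv => by rw [inner_add_right, hx g v hv, hy g v hv, add_zero]
      zero_mem' := fun g v _ => inner_zero_right _
      smul_mem' := fun c x hx g v hv => by rw [inner_smul_right, hx g v hv, mul_zero] }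
  have hZ : IsClosed (Z : Set H) := by
    have : (Z : Set H) = ⋂ g, ⋂ v ∈ W, {x | ⟪ρ g (v : H), x⟫_ℂ = 0} := by
      ext x
      simp [Z]
    rw [this]
    exact isClosed_iInter fun g => isClosed_biInter fun v _ =>
      isClosed_eq (by fun_prop) continuous_const
  have hZinv : ∀ g, ∀ x ∈ Z, ρ g x ∈ Z := by
    intro g x hx h v hv
    have := hx (g⁻¹ * h) v hv
    rwa [rep_mul_apply, inner_rep_left, inv_inv] at this
  rcases hρ.2 Z hZ hZinv with h | h
  · right
    have : CompleteSpace W := hW.completeSpace_coe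
    refine (Submodule.orthogonal_eq_bot_iff).mp ((Submodule.eq_bot_iff _).mpr fun u hu => ?_)
    have huZ : (u : H) ∈ Z := by
      intro g v hv
      rw [← inner_compression_left]
      exact (Submodule.mem_orthogonal W u).mp hu _ (hinv g v hv)
    rw [h] at huZ
    exact Subtype.ext huZ
  · left
    refine (Submodule.eq_bot_iff _).mpr fun v hv => ?_
    have hvZ : (v : H) ∈ Z := h ▸ Submodule.mem_top
    have := hvZ 1 v hv
    rw [rep_one_apply, inner_self_eq_zero] at this
    exact Subtype.ext this

theorem rank_fixedVectors_le_one_of_commute {ρ : G →* (H ≃ₗᵢ[ℂ] H)}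
    (hρ : IsIrreducibleUnitary ρ) (K : Subgroup G)
    (hcomm : ∀ g h, Commute (compression ρ K g) (compression ρ K h)) :
    Module.rank ℂ (fixedVectors ρ K) ≤ 1 :=
  rank_le_one_of_commuting_irreducible (compression ρ K)
    (fun g => ⟨g⁻¹, star_compression ρ K g⟩) hcomm
    (eq_bot_or_eq_top_of_compression_invariant hρ K)

theorem compression_mul_mul (ρ : G →* (H ≃ₗᵢ[ℂ] H)) {K : Subgroup G} {k l : G} (hk : k ∈ K)
    (hl : l ∈ K) (g : G) : compression ρ K (k * g * l) = compression ρ K g := by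
  ext1 v
  refine ext_inner_right ℂ fun w => ?_
  rw [inner_compression_left, inner_compression_left, rep_mul_apply,
    rep_mul_apply, v.2 l hl, inner_rep_left,
    w.2 k⁻¹ (inv_mem hk)]

/-- The mean ergodic theorem for an element `t` whose fixed vectors are the `K`-fixed ones. -/
theorem tendsto_birkhoffAverage_rep (ρ : G →* (H ≃ₗᵢ[ℂ] H)) {K : Subgroup G} {t : G}
    (ht : ∀ x, ρ t x = x ↔ x ∈ fixedVectors ρ K) (x : H) :
    Filter.Tendsto (birkhoffAverage ℂ (ρ t) _root_.id · x) Filter.atTop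
      (𝓝 ((fixedVectors ρ K).orthogonalProjectionOnto x : H)) := by
  let f : H →L[ℂ] H := (ρ t).toContinuousLinearEquiv.toContinuousLinearMap
  have hf : ‖f‖ ≤ 1 := (ρ t).toLinearIsometry.norm_toContinuousLinearMap_le
  have hE : ∀ (E : Submodule ℂ H) [E.HasOrthogonalProjection], E = fixedVectors ρ K →
      (E.orthogonalProjectionOnto x : H) = (fixedVectors ρ K).orthogonalProjectionOnto x := by
    rintro _ _ rfl
    rfl
  have key := f.tendsto_birkhoffAverage_orthogonalProjection hf x
  rwa [hE _ (Submodule.ext ht)] at key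

/-- If all conjugates of `h` by powers of `t` commute with `g`, then averaging over the powers of
`t` shows that the compressions of `g` and `h` commute. -/
theorem commute_compression (ρ : G →* (H ≃ₗᵢ[ℂ] H)) {K : Subgroup G} {t g h : G}
    (htK : t ∈ K) (ht : ∀ x, ρ t x = x → x ∈ fixedVectors ρ K)
    (hc : ∀ j : ℕ, Commute g (t ^ j * h * (t ^ j)⁻¹)) :
    Commute (compression ρ K g) (compression ρ K h) := by
  have ht₁ : ∀ x, ρ t x = x ↔ x ∈ fixedVectors ρ K := fun x => ⟨ht x, fun hx => hx t htK⟩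
  have ht₂ : ∀ x, ρ t⁻¹ x = x ↔ x ∈ fixedVectors ρ K := fun x => by
    rw [← ht₁, map_inv]
    exact (LinearIsometryEquiv.symm_apply_eq _).trans eq_comm
  have hiter : ∀ (s : G) (j : ℕ) (x : H), (ρ s)^[j] x = ρ (s ^ j) x := by
    intro s j x
    induction j with
    | zero => simp
    | succ j ih => rw [Function.iterate_succ_apply', ih, pow_succ', map_mul]; rfl
  have hlim : ∀ (s a : G) (_ : ∀ x, ρ s x = x ↔ x ∈ fixedVectors ρ K) (x w : H),
      Filter.Tendsto (fun N : ℕ => (N : ℂ)⁻¹ • ∑ j ∈ Finset.range N, ⟪w, ρ a (ρ (s ^ j) x)⟫_ℂ)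
        Filter.atTop (𝓝 ⟪w, ρ a ((fixedVectors ρ K).orthogonalProjectionOnto x : H)⟫_ℂ) := by
    intro s a hs x w
    have hcont : Continuous fun z : H => ⟪w, ρ a z⟫_ℂ := by fun_prop
    refine ((hcont.tendsto _).comp (tendsto_birkhoffAverage_rep ρ hs x)).congr fun N => ?_
    simp only [Function.comp_apply, birkhoffAverage, birkhoffSum, map_smul, map_sum,
      inner_smul_right, inner_sum, hiter, id_eq, smul_eq_mul]
  refine ContinuousLinearMap.ext fun v => ext_inner_left ℂ fun w => ?_
  change ⟪w, compression ρ K g (compression ρ K h v)⟫_ℂ =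
    ⟪w, compression ρ K h (compression ρ K g v)⟫_ℂ
  rw [← inner_conj_symm, inner_compression_left, inner_conj_symm, ← inner_conj_symm w,
    inner_compression_left, inner_conj_symm]
  refine tendsto_nhds_unique (hlim t g ht₁ (ρ h v) w) ((hlim t⁻¹ h ht₂ (ρ g v) w).congr fun N => ?_)
  congr 1
  refine Finset.sum_congr rfl fun j _ => ?_
  have htj : t ^ j ∈ K := pow_mem htK j
  calc ⟪(w : H), ρ h (ρ (t⁻¹ ^ j) (ρ g v))⟫_ℂ
      = ⟪ρ (t ^ j) (w : H), ρ (t ^ j) (ρ h (ρ (t⁻¹ ^ j) (ρ g v)))⟫_ℂ :=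
        ((ρ (t ^ j)).inner_map_map _ _).symm
    _ = ⟪(w : H), ρ (t ^ j * h * (t ^ j)⁻¹ * g) v⟫_ℂ := by
        rw [w.2 _ htj, inv_pow]
        simp only [rep_mul_apply]
    _ = ⟪(w : H), ρ g (ρ (t ^ j) (ρ h (ρ (t ^ j)⁻¹ v)))⟫_ℂ := by
        rw [← (hc j).eq]
        simp only [rep_mul_apply]
    _ = _ := by rw [v.2 _ (inv_mem htj)]

end Compression

/-! ### Permutation representations -/

section Permutation

variable {Ω : Type u}

/-- The unitary operator in `ℓ²(Ω)` determined by a permutation of `Ω`. -/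
noncomputable def permIsometry (e : Equiv.Perm Ω) :
    lp (fun _ : Ω => ℂ) 2 ≃ₗᵢ[ℂ] lp (fun _ : Ω => ℂ) 2 := by
  have h2 : 0 < (2 : ENNReal).toReal := by norm_num
  have hmem : ∀ (e : Equiv.Perm Ω) (f : lp (fun _ : Ω => ℂ) 2),
      Memℓp (E := fun _ : Ω => ℂ) (fun i => f (e i)) 2 := fun e f =>
    (memℓp_gen_iff h2).mpr (e.summable_iff.mpr ((memℓp_gen_iff h2).mp (lp.memℓp f)))
  exact
    { toFun := fun f => ⟨fun i => f (e.symm i), hmem e.symm f⟩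
      invFun := fun f => ⟨fun i => f (e i), hmem e f⟩
      left_inv := fun f => lp.ext (funext fun i => congrArg f (e.symm_apply_apply i))
      right_inv := fun f => lp.ext (funext fun i => congrArg f (e.apply_symm_apply i))
      map_add' := fun f g => rfl
      map_smul' := fun c f => rfl
      norm_map' := fun f => by
        rw [lp.norm_eq_tsum_rpow h2, lp.norm_eq_tsum_rpow h2]
        congr 1
        exact e.symm.tsum_eq fun i => ‖f i‖ ^ (2 : ENNReal).toReal }

theorem permIsometry_apply (e : Equiv.Perm Ω) (f : lp (fun _ : Ω => ℂ) 2) (i : Ω) :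
    permIsometry e f i = f (e.symm i) := rfl

theorem permIsometry_single [DecidableEq Ω] (e : Equiv.Perm Ω) (i : Ω) (c : ℂ) :
    permIsometry e (lp.single 2 i c) = lp.single 2 (e i) c := by
  refine lp.ext (funext fun j => ?_)
  rw [permIsometry_apply, lp.single_apply, lp.single_apply]
  by_cases hj : j = e i
  · subst hj
    rw [e.symm_apply_apply, Pi.single_eq_same, Pi.single_eq_same]
  · rw [Pi.single_eq_of_ne hj, Pi.single_eq_of_ne fun h => hj ((e.symm_apply_eq).mp h)]

variable {G : Type u} [Group G] [MulAction G Ω]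

/-- The representation of a group in `ℓ²(Ω)` determined by an action on `Ω`. -/
noncomputable def permRep (G : Type u) [Group G] (Ω : Type u) [MulAction G Ω] :
    G →* (lp (fun _ : Ω => ℂ) 2 ≃ₗᵢ[ℂ] lp (fun _ : Ω => ℂ) 2) where
  toFun g := permIsometry (MulAction.toPerm g)
  map_one' := by
    refine LinearIsometryEquiv.ext fun f => lp.ext (funext fun i => congrArg f ?_)
    exact (MulAction.toPerm (1 : G)).symm_apply_eq.mpr (one_smul G i).symm
  map_mul' g h := by
    refine LinearIsometryEquiv.ext fun f => lp.ext (funext fun i => congrArg f ?_)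
    exact (MulAction.toPerm (g * h)).symm_apply_eq.mpr (by
      change i = (g * h) • (h⁻¹ • g⁻¹ • i)
      rw [mul_smul, smul_inv_smul, smul_inv_smul])

theorem permRep_single [DecidableEq Ω] (g : G) (i : Ω) (c : ℂ) :
    permRep G Ω g (lp.single 2 i c) = lp.single 2 (g • i) c :=
  permIsometry_single (MulAction.toPerm g) i c

theorem single_injective [DecidableEq Ω] {i j : Ω}
    (h : lp.single (E := fun _ : Ω => ℂ) 2 i (1 : ℂ) =
      lp.single (E := fun _ : Ω => ℂ) 2 j (1 : ℂ)) : i = j := by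
  by_contra hij
  have h1 : lp.single (E := fun _ : Ω => ℂ) 2 i (1 : ℂ) i =
      lp.single (E := fun _ : Ω => ℂ) 2 j (1 : ℂ) i := by rw [h]
  rw [lp.single_apply_self, lp.single_apply_ne 2 j _ hij] at h1
  exact one_ne_zero h1

theorem isStronglyContinuous_permRep [TopologicalSpace G] [IsTopologicalGroup G]
    (hopen : ∀ i : Ω, IsOpen (MulAction.stabilizer G i : Set G)) :
    IsStronglyContinuous (permRep G Ω) := by
  classical
  have hsingle : ∀ (i : Ω) (c : ℂ), Continuous fun g => permRep G Ω g (lp.single 2 i c) := by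
    intro i c
    refine continuous_iff_continuousAt.mpr fun g => ?_
    have : (fun _ => permRep G Ω g (lp.single 2 i c)) =ᶠ[𝓝 g]
        fun g' => permRep G Ω g' (lp.single 2 i c) := by
      have hU : (fun g' => g⁻¹ * g') ⁻¹' (MulAction.stabilizer G i : Set G) ∈ 𝓝 g := by
        refine ((hopen i).preimage (continuous_const_mul g⁻¹)).mem_nhds ?_
        change g⁻¹ * g ∈ MulAction.stabilizer G i
        rw [inv_mul_cancel]
        exact one_mem _
      filter_upwards [hU] with g' hg'
      have : (g⁻¹ * g') • i = i := hg'
      rw [mul_smul, inv_smul_eq_iff] at this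
      rw [permRep_single, permRep_single, this]
    exact continuousAt_const.congr this
  intro f
  refine continuous_of_uniform_approx_of_continuous fun u hu => ?_
  obtain ⟨ε, hε, hεu⟩ := Metric.mem_uniformity_dist.mp hu
  have hsum := lp.hasSum_single (E := fun _ : Ω => ℂ) (p := 2) (by norm_num) f
  obtain ⟨s, hs⟩ := (Metric.tendsto_nhds.mp hsum ε hε).exists
  refine ⟨fun g => permRep G Ω g (∑ i ∈ s, lp.single 2 i (f i)), ?_, fun g => hεu ?_⟩
  · simp only [map_sum]
    exact continuous_finsetSum _ fun i _ => hsingle i (f i)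
  · rw [(permRep G Ω g).dist_map, dist_comm]
    exact hs

/-- If the open subgroups of `G` intersect in the identity, then the sum of the quasi-regular
representations over all open subgroups is faithful; the stabilizer of the base point of `G ⧸ K`
is `K`. -/
theorem exists_faithful_rep_of_isOpen [TopologicalSpace G] [IsTopologicalGroup G] (K : Subgroup G)
    (hK : IsOpen (K : Set G))
    (hsep : ∀ g : G, g ≠ 1 → ∃ U : Subgroup G, IsOpen (U : Set G) ∧ g ∉ U) :
    ∃ (H : Type u) (_ : NormedAddCommGroup H) (_ : InnerProductSpace ℂ H) (_ : CompleteSpace H)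
      (ρ : G →* (H ≃ₗᵢ[ℂ] H)), IsStronglyContinuous ρ ∧ Function.Injective ρ ∧
        ∃ v : H, ∀ g : G, ρ g v = v ↔ g ∈ K := by
  classical
  let Ω : Type u := Σ U : {U : Subgroup G // IsOpen (U : Set G)}, G ⧸ U.1
  have hsmul : ∀ (g : G) (U : {U : Subgroup G // IsOpen (U : Set G)}),
      g • (⟨U, ((1 : G) : G ⧸ U.1)⟩ : Ω) = ⟨U, ((1 : G) : G ⧸ U.1)⟩ ↔ g ∈ U.1 := by
    intro g U
    rw [Sigma.smul_mk, Sigma.mk.injEq, heq_eq_eq, and_iff_right rfl]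
    change ((g * 1 : G) : G ⧸ U.1) = ((1 : G) : G ⧸ U.1) ↔ _
    rw [eq_comm, QuotientGroup.eq, mul_one, inv_one, one_mul]
  have hopen : ∀ i : Ω, IsOpen (MulAction.stabilizer G i : Set G) := by
    rintro ⟨U, x⟩
    obtain ⟨h, rfl⟩ := QuotientGroup.mk_surjective x
    have : (MulAction.stabilizer G (⟨U, (h : G ⧸ U.1)⟩ : Ω) : Set G) =
        (fun g => h⁻¹ * g * h) ⁻¹' (U.1 : Set G) := by
      ext g
      change g • (⟨U, (h : G ⧸ U.1)⟩ : Ω) = ⟨U, (h : G ⧸ U.1)⟩ ↔ h⁻¹ * g * h ∈ U.1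
      rw [Sigma.smul_mk, Sigma.mk.injEq, heq_eq_eq, and_iff_right rfl]
      change ((g * h : G) : G ⧸ U.1) = (h : G ⧸ U.1) ↔ _
      rw [eq_comm, QuotientGroup.eq, mul_assoc]
    rw [this]
    exact U.2.preimage (by fun_prop)
  refine ⟨lp (fun _ : Ω => ℂ) 2, inferInstance, inferInstance, inferInstance, permRep G Ω,
    isStronglyContinuous_permRep hopen, ?_, lp.single 2 ⟨⟨K, hK⟩, ((1 : G) : G ⧸ K)⟩ 1,
    fun g => ?_⟩
  · refine (injective_iff_map_eq_one _).mpr fun g hg => ?_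
    by_contra hne
    obtain ⟨U, hU, hgU⟩ := hsep g hne
    refine hgU ((hsmul g ⟨U, hU⟩).mp (single_injective ?_))
    rw [← permRep_single, hg]
    rfl
  · rw [permRep_single]
    exact ⟨fun h => (hsmul g ⟨K, hK⟩).mp (single_injective h),
      fun h => by rw [(hsmul g ⟨K, hK⟩).mpr h]⟩

end Permutation

/-! ### Vectors fixed by a translation -/

namespace SimpleGraph

variable {V : Type u} {T : SimpleGraph V} {p q : V} {n : ℕ}

theorem iso_inv_apply_eq {k : T ≃g T} {x y : V} : k⁻¹ x = y ↔ x = k y := k.symm_apply_eq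

theorem IsTree.translation_branch_subset (hT : T.IsTree) (hpq : T.Adj p q) {t : T ≃g T}
    (ht : t p = q) (hne : t q ≠ p) : T.branch (t p) (t q) ⊆ T.branch p q := by
  have hqt := t.map_adj_iff.mpr hpq
  rw [ht] at hqt ⊢
  exact hT.branch_subset hpq hqt hne

theorem IsTree.absHomeo_pow_mem_absBall (hT : T.IsTree) (hpq : T.Adj p q) {t : T ≃g T}
    (ht : t p = q) (hne : t q ≠ p) (j : ℕ) {x : T.Abs} (hx : x ∈ T.absBall p q) :
    T.absHomeo (t ^ j) x ∈ T.absBall p q := by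
  induction j with
  | zero =>
    rw [pow_zero, map_one]
    exact hx
  | succ j ih =>
    rw [pow_succ', map_mul]
    exact absBall_mono (hT.translation_branch_subset hpq ht hne) (absMap_mem_absBall t ih)

/-- A translation along the edge `(p, q)` eventually moves any vertex into the branch at
`(p, q)`. -/
theorem IsTree.eventually_pow_mem_branch (hT : T.IsTree) (hpq : T.Adj p q) {t : T ≃g T}
    (ht : t p = q) (hne : t q ≠ p) (v : V) :
    ∀ᶠ j in Filter.atTop, (t ^ j) v ∈ T.branch p q := by
  have hstep : ∀ x ∈ T.branch p q, t x ∈ T.branch p q := fun x hx =>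
    hT.translation_branch_subset hpq ht hne (map_mem_branch t hx)
  have hsucc : ∀ j x, (t ^ (j + 1)) x = t ((t ^ j) x) := fun j x => by rw [pow_succ']; rfl
  suffices H : ∃ m : ℕ, (t ^ m) v ∈ T.branch p q by
    obtain ⟨m, hm⟩ := H
    refine Filter.eventually_atTop.mpr ⟨m, fun j hj => ?_⟩
    induction j, hj using Nat.le_induction with
    | base => exact hm
    | succ j _ ih =>
      rw [hsucc]
      exact hstep _ ih
  refine hT.vertex_induction (P := fun v => ∃ m : ℕ, (t ^ m) v ∈ T.branch p q)
    (a := q) ⟨0, self_mem_branch p q⟩ ?_ v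
  rintro u v ⟨m, hm⟩ huv
  by_cases hv : (t ^ m) v ∈ T.branch p q
  · exact ⟨m, hv⟩
  · obtain ⟨-, e⟩ := eq_of_adj_of_mem_of_notMem hm hv ((t ^ m).map_adj_iff.mpr huv) hT hpq
    refine ⟨m + 1, ?_⟩
    rw [hsucc, e, ht]
    exact self_mem_branch p q

section Mautner

variable {H : Type w} [NormedAddCommGroup H] [InnerProductSpace ℂ H]
  {ρ : T.Hier →* (H ≃ₗᵢ[ℂ] H)}

/-- If `k` fixes pointwise the branch that attracts the translation `t`, then its conjugates
`t ^ (-j) * k * t ^ j` tend to the identity, so `k` fixes all vectors fixed by `t`. -/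
theorem rep_apply_eq_of_fixes_branch (hT : T.IsTree) (hρ : IsStronglyContinuous ρ)
    (hpq : T.Adj p q) {t : T ≃g T} (ht : t p = q) (hne : t q ≠ p) {y : H}
    (hy : ρ (T.autToHier t) y = y) {k : T ≃g T} (hk : ∀ v ∈ T.branch p q, k v = v) :
    ρ (T.autToHier k) y = y := by
  refine eq_of_forall_dist_le fun ε hε => ?_
  have hnhds : {g | Dist.dist (ρ g y) y < ε} ∈ 𝓝 (1 : T.Hier) := by
    have hball : Metric.ball y ε ∈ 𝓝 (ρ (1 : T.Hier) y) := by
      rw [rep_one_apply]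
      exact Metric.ball_mem_nhds y hε
    exact (hρ y).continuousAt hball
  obtain ⟨F, hF⟩ := Hier.mem_nhds_iff.mp hnhds
  obtain ⟨j, hj⟩ := ((Filter.eventually_all_finset F).mpr fun v _ =>
    hT.eventually_pow_mem_branch hpq ht hne v).exists
  have hfix : ∀ v ∈ F, ((t ^ j)⁻¹ * k * t ^ j) v = v := fun v hv => by
    change (t ^ j)⁻¹ (k ((t ^ j) v)) = v
    rw [hk _ (hj v hv), iso_inv_apply_eq]
  have hyj : ρ (T.autToHier (t ^ j)) y = y := by
    clear hj hfix
    induction j with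
    | zero => rw [pow_zero, map_one, rep_one_apply]
    | succ j ih => rw [pow_succ, map_mul, rep_mul_apply, hy, ih]
  have key : Dist.dist (ρ (1 * T.autToHier ((t ^ j)⁻¹ * k * t ^ j)) y) y < ε := hF _ ⟨_, hfix, rfl⟩
  rw [one_mul, ← (ρ (T.autToHier (t ^ j))).dist_map, ← rep_mul_apply, ← map_mul, hyj,
    show t ^ j * ((t ^ j)⁻¹ * k * t ^ j) = k * t ^ j by group, map_mul, rep_mul_apply, hyj] at key
  exact key.le

/-- A vector fixed by a translation along an edge is fixed by all automorphisms: the automorphisms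
that fix pointwise one of the two branches at the edge generate, together with the translation, the
whole group. -/
theorem rep_apply_eq_of_translation_fixed (hT : T.IsTree) (hn : 2 ≤ n)
    (hdeg : ∀ v : V, (T.neighborSet v).ncard = n + 1) (hρ : IsStronglyContinuous ρ)
    (hpq : T.Adj p q) {t : T ≃g T} (ht : t p = q) (hne : t q ≠ p) {y : H}
    (hy : ρ (T.autToHier t) y = y) (k : T ≃g T) : ρ (T.autToHier k) y = y := by
  let Γ : Subgroup (T ≃g T) :=
    { carrier := {k | ρ (T.autToHier k) y = y}
      one_mem' := by
        change ρ (T.autToHier 1) y = y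
        rw [map_one, rep_one_apply]
      mul_mem' := fun {a b} ha hb => by
        change ρ (T.autToHier (a * b)) y = y
        rw [map_mul, rep_mul_apply, show ρ (T.autToHier b) y = y from hb]
        exact ha
      inv_mem' := fun {a} ha => by
        change ρ (T.autToHier a⁻¹) y = y
        rw [map_inv, map_inv]
        exact (ρ (T.autToHier a)).symm_apply_eq.mpr (show ρ (T.autToHier a) y = y from ha).symm }
  change k ∈ Γ
  have htΓ : t ∈ Γ := hy
  obtain ⟨r, hr⟩ : ∃ r, t q = r := ⟨_, rfl⟩
  rw [hr] at hne
  have hqr : T.Adj q r := by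
    have := t.map_adj_iff.mpr hpq
    rwa [ht, hr] at this
  have hrq : t r ≠ q := fun e => hne (t.injective (e.trans ht.symm))
  have fwd : ∀ k : T ≃g T, (∀ v ∈ T.branch q r, k v = v) → k ∈ Γ := fun k hk =>
    rep_apply_eq_of_fixes_branch hT hρ hqr hr hrq hy hk
  have bwd : ∀ k : T ≃g T, (∀ v ∈ T.branch q p, k v = v) → k ∈ Γ := fun k hk => by
    have hy' : ρ (T.autToHier t⁻¹) y = y := inv_mem htΓ
    refine rep_apply_eq_of_fixes_branch hT hρ hpq.symm (iso_inv_apply_eq.mpr ht.symm) ?_ hy' hk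
    exact fun e => hne ((iso_inv_apply_eq.mp e).trans hr).symm
  -- The stabilizer of `q` is contained in `Γ`.
  have stab₁ : ∀ k : T ≃g T, k q = q → k r = r → k ∈ Γ := by
    intro k hkq hkr
    obtain ⟨l, hl, hl'⟩ := hT.exists_cutoff hqr k hkq hkr
    have h1 : l ∈ Γ := bwd l fun v hv => hl' v
      (hT.notMem_branch_of_mem hqr.symm (hT.branch_subset hqr.symm hpq.symm hne.symm hv))
    have h2 : l⁻¹ * k ∈ Γ := fwd _ fun v hv => iso_inv_apply_eq.mpr (hl v hv).symm
    have := mul_mem h1 h2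
    rwa [mul_inv_cancel_left] at this
  have stab₂ : ∀ k : T ≃g T, k q = q → k r ≠ p → k ∈ Γ := by
    intro k hkq hkr
    have hadj : T.Adj q (k r) := by
      have := k.map_adj_iff.mpr hqr
      rwa [hkq] at this
    obtain ⟨l, hl, hl', hl''⟩ := hT.exists_iso_fixing_branch hn hdeg hpq.symm hadj hqr hkr hne
    have h1 : l * k ∈ Γ := stab₁ _ ((congrArg l hkq).trans hl) hl'
    exact (Γ.mul_mem_cancel_left (bwd l hl'')).mp h1
  have stab : ∀ k : T ≃g T, k q = q → k ∈ Γ := by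
    intro k hkq
    by_cases hkr : k r = p
    · obtain ⟨c, hc, hcp, hcr⟩ := exists_adj_ne_ne hn hdeg q p r
      obtain ⟨l, hl, hl', hl''⟩ :=
        hT.exists_iso_fixing_branch hn hdeg hqr hpq.symm hc hne.symm hcr
      have h1 : l * k ∈ Γ := stab₂ _ ((congrArg l hkq).trans hl) (by
        change l (k r) ≠ p
        rwa [hkr, hl'])
      exact (Γ.mul_mem_cancel_left (fwd l hl'')).mp h1
    · exact stab₂ k hkq hkr
  have trans : ∀ v, ∃ γ ∈ Γ, γ q = v := by
    refine hT.vertex_induction ⟨1, one_mem Γ, rfl⟩ ?_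
    rintro _ u ⟨γ, hγ, rfl⟩ hu
    have hadj : T.Adj q (γ⁻¹ u) := by
      have := (γ⁻¹).map_adj_iff.mpr hu
      rwa [iso_inv_apply_eq.mpr rfl] at this
    obtain ⟨κ, h1, h2⟩ := hT.exists_iso_dart hn hdeg hqr hadj
    refine ⟨γ * κ * t, mul_mem (mul_mem hγ (stab κ h1)) htΓ, ?_⟩
    change γ (κ (t q)) = u
    rw [hr, h2]
    exact (iso_inv_apply_eq.mp rfl).symm
  obtain ⟨γ, hγ, h⟩ := trans (k q)
  have h1 : γ⁻¹ * k ∈ Γ := stab _ (iso_inv_apply_eq.mpr h.symm)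
  exact (Γ.mul_mem_cancel_left (inv_mem hγ)).mp h1

end Mautner

/-! ### Sphericity -/

/-- Up to an automorphism, a spheromorphism is the identity on some ball. -/
theorem Hier.exists_aut_mul_eq_on_absBall (hT : T.IsTree) (g : T.Hier) (a : T.Way) :
    ∃ k : T ≃g T, ∃ p q, T.Adj p q ∧
      ∀ x ∈ T.absBall p q, Hier.toHomeo T (T.autToHier k * g) x = x := by
  obtain ⟨N, hN, r, hr⟩ := g.exists_eq_absHomeo_on a.toAbs
  obtain ⟨i, hi⟩ := a.exists_absBall_subset hT hN
  refine ⟨r⁻¹, _, _, a.adj i, fun x hx => ?_⟩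
  rw [Hier.toHomeo_mul_apply, hr x (hi hx)]
  exact absMap_inv_absMap r x

/-- Spheromorphisms that are the identity on complementary balls commute. -/
theorem Hier.commute_of_eq_on_absBall (hT : T.IsTree) (hpq : T.Adj p q) {g h : T.Hier}
    (hg : ∀ x ∈ T.absBall p q, Hier.toHomeo T g x = x)
    (hh : ∀ x ∈ T.absBall q p, Hier.toHomeo T h x = x) : Commute g h := by
  have pres : ∀ {p q : V}, T.Adj p q → ∀ {g : T.Hier},
      (∀ x ∈ T.absBall p q, Hier.toHomeo T g x = x) →
      ∀ x ∈ T.absBall q p, Hier.toHomeo T g x ∈ T.absBall q p := by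
    intro p q hpq g hg x hx
    refine (hT.mem_absBall_swap_iff hpq).mpr fun hgx => ?_
    have := (Hier.toHomeo T g).injective (hg _ hgx)
    rw [this] at hgx
    exact hT.notMem_absBall_of_mem hpq hgx hx
  refine Hier.ext fun x => ?_
  rw [Hier.toHomeo_mul_apply, Hier.toHomeo_mul_apply]
  rcases hT.mem_absBall_or hpq x with hx | hx
  · rw [hg x hx, hg _ (pres hpq.symm hh x hx)]
  · rw [hh x hx, hh _ (pres hpq hg x hx)]

/-- Modulo automorphisms two spheromorphisms `g` and `h` can be moved into complementary branches;
then `g` commutes with all conjugates of `h` by the positive powers of a translation. -/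
theorem commute_compression_hier (hT : T.IsTree) (hn : 2 ≤ n)
    (hdeg : ∀ v : V, (T.neighborSet v).ncard = n + 1) {H : Type w} [NormedAddCommGroup H]
    [InnerProductSpace ℂ H] [CompleteSpace H] {ρ : T.Hier →* (H ≃ₗᵢ[ℂ] H)}
    (hρ : IsStronglyContinuous ρ) (a : T.Way) (g h : T.Hier) :
    Commute (compression ρ T.autSubgroup g) (compression ρ T.autSubgroup h) := by
  have hK : ∀ k : T ≃g T, T.autToHier k ∈ T.autSubgroup := fun k => ⟨k, rfl⟩
  obtain ⟨k, q, p, hqp, hk⟩ := Hier.exists_aut_mul_eq_on_absBall hT h a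
  obtain ⟨l, p', q', hpq', hl⟩ := Hier.exists_aut_mul_eq_on_absBall hT g a
  obtain ⟨m, rfl, rfl⟩ := hT.exists_iso_dart hn hdeg hpq' hqp.symm
  obtain ⟨t, ht, hne⟩ := hT.exists_translation hn hdeg hqp.symm
  have hg : ∀ x ∈ T.absBall (m p') (m q'), Hier.toHomeo T
      (T.autToHier (m * l) * g * T.autToHier m⁻¹) x = x := by
    intro x hx
    have hx' : T.absHomeo m⁻¹ x ∈ T.absBall p' q' := by
      rw [← absHomeo_mem_absBall_iff m,
        show T.absHomeo m (T.absHomeo m⁻¹ x) = x from absMap_absMap_inv m x]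
      exact hx
    rw [map_mul T.autToHier, mul_assoc, mul_assoc, Hier.toHomeo_mul_apply, ← mul_assoc,
      Hier.toHomeo_mul_apply, Hier.toHomeo_autToHier m⁻¹, hl _ hx']
    exact absMap_absMap_inv m x
  rw [← compression_mul_mul ρ (hK (m * l)) (hK m⁻¹) g, ← compression_mul_mul ρ (hK k) (one_mem _) h,
    mul_one]
  refine commute_compression ρ (hK t) (fun x hx => ?_) fun j => ?_
  · rintro _ ⟨s, rfl⟩
    exact rep_apply_eq_of_translation_fixed hT hn hdeg hρ hqp.symm ht hne hx s
  · refine Hier.commute_of_eq_on_absBall hT hqp.symm hg fun x hx => ?_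
    have hx' : T.absHomeo (t ^ j)⁻¹ x ∈ T.absBall (m q') (m p') := by
      rw [← inv_pow]
      exact hT.absHomeo_pow_mem_absBall hqp (iso_inv_apply_eq.mpr ht.symm)
        (fun e => hne (iso_inv_apply_eq.mp e).symm) j hx
    rw [mul_assoc, Hier.toHomeo_mul_apply, Hier.toHomeo_mul_apply, ← map_pow, ← map_inv,
      Hier.toHomeo_autToHier, Hier.toHomeo_autToHier, hk _ hx']
    exact absMap_absMap_inv (t ^ j) x

end SimpleGraph

theorem theorem1 (n : ℕ) (hn : 2 ≤ n) {V : Type u} (T : SimpleGraph V) (hT : T.IsTree)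
    (hdeg : ∀ v : V, (T.neighborSet v).ncard = n + 1) :
    IsSphericalSubgroup.{u, w} T.Hier T.autSubgroup := by
  have hfin : ∀ v, (T.neighborSet v).Finite := fun v =>
    Set.finite_of_ncard_ne_zero (by rw [hdeg]; exact Nat.succ_ne_zero n)
  obtain ⟨p⟩ := hT.connected.nonempty
  obtain ⟨q, hpq, -⟩ := SimpleGraph.exists_adj_ne_ne hn hdeg p p p
  obtain ⟨t, rfl, hne⟩ := hT.exists_translation hn hdeg hpq
  have hgroup : IsTopologicalGroup T.Hier := SimpleGraph.isTopologicalGroup_hier hT hfin hpq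
  refine ⟨hgroup, ?_, ?_, ?_⟩
  · exact Subgroup.isClosed_of_isOpen _ SimpleGraph.isOpen_autSubgroup
  · intro H _ _ _ ρ hρ hirr
    exact rank_fixedVectors_le_one_of_commute hirr _
      (SimpleGraph.commute_compression_hier hT hn hdeg hρ (SimpleGraph.translationWay t hpq hne))
  · refine exists_faithful_rep_of_isOpen _ SimpleGraph.isOpen_autSubgroup fun g hg => ?_
    obtain ⟨x, hx⟩ : ∃ x, SimpleGraph.Hier.toHomeo T g x ≠ x := by
      by_contra! H
      exact hg (SimpleGraph.Hier.ext H)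
    obtain ⟨a, b, hab, hxa, hgx⟩ := hT.exists_absBall_separating (Ne.symm hx)
    classical
    refine ⟨_, SimpleGraph.isOpen_of_fixatorSubgroup_le (F := {a, b}) le_rfl, ?_⟩
    rintro ⟨k, hk, rfl⟩
    exact hgx ((SimpleGraph.absHomeo_mem_absBall_iff_of_fixed (hk a (by simp))
      (hk b (by simp))).mpr hxa)
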